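/- \textbf{Setting.} A signed graph $G=(V,E,\sigma)$ on $V=[N]$ is a simple undirected graph with a sign $\sigma(e)\in\{+,-\}$ on every edge. It is \emph{clusterable} if $V$ can be partitioned so that every positive edge joins two nodes of the same part and every negative edge joins two nodes of different parts. Let all degrees of $G$ be at most $d$. For $\epsilon>0$, $G$ is \emph{$\epsilon$-far from clusterable} if at least $\epsilon dN$ edge modifications (additions, removals or sign switches) are needed to turn $G$ into a clusterable graph. An algorithm accesses $G$ through queries $(v,i)\in[N]\times[d]$; the answer is the $i$-th neighbour $w$ of $v$ (neighbours listed in arbitrary order) together with $\sigma(v,w)$, or an error symbol if $v$ has fewer than $i$ neighbours. A \emph{bad cycle} is a cycle with exactly one negative edge. A step of the random walk on the positive edges moves from $v$ to each positive neighbour of $v$ with probability $1/d$ and stays at $v$ otherwise. \textbf{Algorithm} (parameters $r,m,L$). Repeat $r$ times: pick a uniformly random node $s$ and run $\mathrm{BadCycle}(s)$; reject if it finds a bad cycle. Accept if this never happens. Here $\mathrm{BadCycle}(s)$ performs $m$ independent random walks of length $L$ on the positive edges from $s$, lets $K$ be the set of all visited nodes, queries the full neighbourhood of the nodes of $K$,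 and, if there is a negative edge between two nodes of $K$, returns such an edge (as the witness of a bad cycle). \textbf{Theorem.} There are universal constants $C,k,C',k'\in\mathbb{N}$ such that the following holds for all $N\ge 1$, $d\ge 1$ and $0<\epsilon\le 1$. Run the algorithm with $$r=\Big\lceil \frac{C}{\epsilon}\Big\rceil,\qquad L=\Big\lceil C\Big(\frac{d(1+\log N)}{\epsilon}\Big)^{k}\Big\rceil,\qquad m=\Big\lceil C\sqrt N\Big(\frac{d(1+\log N)}{\epsilon}\Big)^{k}\Big\rceil .$$ For every signed graph $G$ on $[N]$ with degrees at most $d$, and every ordering of its adjacency lists: \begin{enumerate} \item if $G$ is clusterable, the algorithm accepts with probability $1$; \item if $G$ is $\epsilon$-far from clusterable, the algorithm rejects with probability at least $2/3$; \item every edge that $\mathrm{BadCycle}(s)$ returns is a negative edge of $G$ and lies on a bad cycle of $G$; \item the algorithm never makes more than $C'\sqrt N\,\big(d(1+\log N)/\epsilon\big)^{k'}$ queries. \end{enumerate} That is, the algorithm is a one-sided tester for clusterability in the bounded-degree signed graph model with query complexity $\widetilde O(\sqrt N/\mathrm{poly}(\epsilon))$, where $\widetilde O$ hides factors polylogarithmic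 in $N$ and polynomial in $d$. -/

import Mathlib

/-! ### Signed graphs -/

/-- A (simple, undirected) signed graph on the node set `V`, given by its signed adjacency matrix:
`label u v` is `1` for a positive edge, `-1` for a negative edge, and `0` if there is no edge. -/
structure SignedGraph (V : Type) where
  label : V → V → SignType
  symm : ∀ u v, label u v = label v u
  loopless : ∀ v, label v v = 0

namespace SignedGraph

/-- The underlying unsigned graph. -/
def graph {V : Type} (G : SignedGraph V) : SimpleGraph V where
  Adj u v := G.label u v ≠ 0
  symm := ⟨fun u v h => by rw [G.symm v u]; exact h⟩
  loopless := ⟨fun v h => h (G.loopless v)⟩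

/-- A signed graph is clusterable if the nodes can be partitioned (an equivalence relation is the
same thing as a partition) such that positive edges join nodes of the same part and negative edges
join nodes of different parts. -/
def Clusterable {V : Type} (G : SignedGraph V) : Prop :=
  ∃ P : Setoid V,
    (∀ u v, G.label u v = 1 → P u v) ∧ (∀ u v, G.label u v = -1 → ¬ P u v)

/-- A bad cycle: a cycle of the underlying graph with exactly one negative edge. -/
def IsBadCycle {V : Type} (G : SignedGraph V) {u : V} (w : G.graph.Walk u u) : Prop :=
  w.IsCycle ∧ w.darts.countP (fun e => G.label e.fst e.snd = -1) = 1

/-- The number of edge modifications (additions, removals, sign switches) that turn `G` into `G'`: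
the number of unordered pairs of nodes on which the labels differ. -/
def editDistance {N : ℕ} (G G' : SignedGraph (Fin N)) : ℕ :=
  (Finset.univ.filter fun p : Fin N × Fin N =>
    p.1 < p.2 ∧ G.label p.1 p.2 ≠ G'.label p.1 p.2).card

/-- `G` is `ε`-far from clusterable in the bounded-degree model with degree bound `d`. -/
def FarFromClusterable {N : ℕ} (G : SignedGraph (Fin N)) (d : ℕ) (ε : ℝ) : Prop :=
  ∀ G' : SignedGraph (Fin N), G'.Clusterable → ε * d * N ≤ (G.editDistance G' : ℝ)

/-- The degree of a node (counting both positive and negative edges). -/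
def degree {N : ℕ} (G : SignedGraph (Fin N)) (v : Fin N) : ℕ :=
  (Finset.univ.filter fun w => G.label v w ≠ 0).card

/-- An adjacency list representation of `G` with degree bound `d`: all degrees are at most `d`, and
the neighbours of every node are listed in some arbitrary order. -/
structure AdjList {N : ℕ} (G : SignedGraph (Fin N)) (d : ℕ) where
  degree_le : ∀ v, G.degree v ≤ d
  nbr : ∀ v, Fin (G.degree v) ≃ {w : Fin N // G.label v w ≠ 0}

/-- The answer to the query `(v, i)`: the `i`-th neighbour `w` of `v` and the sign of the edge
`(v, w)`, or the error symbol `none` if `v` has no `i`-th neighbour (indices start at zero). -/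
def AdjList.answer {N d : ℕ} {G : SignedGraph (Fin N)} (A : G.AdjList d)
    (v : Fin N) (i : Fin d) : Option (Fin N × SignType) :=
  if h : i.val < G.degree v then
    some ((A.nbr v ⟨i.val, h⟩).val, G.label v (A.nbr v ⟨i.val, h⟩).val)
  else none

end SignedGraph

/-! ### Randomized algorithms with query access -/

/-- A randomized algorithm with output in `α` and adjacency list query access to a signed graph on
`N` nodes with degree bound `d`. It can output a value, make a query and continue depending on the
answer, or draw a uniformly random element of `{0, …, n - 1}` and continue depending on it. -/
inductive QueryAlg (N d : ℕ) (α : Type) : Type where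
  | output (a : α) : QueryAlg N d α
  | query (v : Fin N) (i : Fin d) (next : Option (Fin N × SignType) → QueryAlg N d α) :
      QueryAlg N d α
  | sample (n : ℕ) [NeZero n] (next : Fin n → QueryAlg N d α) : QueryAlg N d α

namespace QueryAlg

/-- Sequential composition. -/
def bind {N d : ℕ} {α β : Type} : QueryAlg N d α → (α → QueryAlg N d β) → QueryAlg N d β
  | output a, f => f a
  | query v i next, f => query v i fun x => (next x).bind f
  | sample n next, f => sample n fun j => (next j).bind f

/-- The distribution of the output, when queries are answered by `ans`. -/
noncomputable def eval {N d : ℕ} {α : Type} (ans : Fin N → Fin d → Option (Fin N × SignType)) :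
    QueryAlg N d α → PMF α
  | output a => PMF.pure a
  | query v i next => (next (ans v i)).eval ans
  | sample n next => (PMF.uniformOfFintype (Fin n)).bind fun j => (next j).eval ans

/-- The maximal number of queries, over all outcomes of the random choices, that the algorithm makes
when queries are answered by `ans`. -/
def queryCount {N d : ℕ} {α : Type} (ans : Fin N → Fin d → Option (Fin N × SignType)) :
    QueryAlg N d α → ℕ
  | output _ => 0
  | query v i next => 1 + (next (ans v i)).queryCount ans
  | sample _ next => Finset.univ.sup fun j => (next j).queryCount ans

end QueryAlg

/-! ### The tester -/

namespace ClusterTester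

/-- One step of the random walk on the positive edges: each positive neighbour of `v` is chosen with
probability `1 / d`, and with the remaining probability the walk stays at `v`. -/
def walkStep {N d : ℕ} [NeZero d] (v : Fin N) : QueryAlg N d (Fin N) :=
  .sample d fun i => .query v i fun
    | some (w, σ) => .output (if σ = 1 then w else v)
    | none => .output v

/-- A random walk of length `L` on the positive edges; the output lists all visited nodes. -/
def walk {N d : ℕ} [NeZero d] : (L : ℕ) → (v : Fin N) → QueryAlg N d (List (Fin N))
  | 0, v => .output [v]
  | L + 1, v => (walkStep v).bind fun w => (walk L w).bind fun l => .output (v :: l)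

/-- `m` independent random walks of length `L` from `s`; the output lists all visited nodes. -/
def walks {N d : ℕ} [NeZero d] (L : ℕ) (s : Fin N) : (m : ℕ) → QueryAlg N d (List (Fin N))
  | 0 => .output []
  | m + 1 => (walk L s).bind fun l => (walks L s m).bind fun l' => .output (l ++ l')

/-- Make the listed queries; stop when a negative edge to a node in `K` is found, and return it. -/
def findNegative {N d : ℕ} (K : List (Fin N)) :
    List (Fin N × Fin d) → QueryAlg N d (Option (Fin N × Fin N))
  | [] => .output none
  | (v, i) :: qs => .query v i fun
    | some (w, σ) => if σ = -1 ∧ w ∈ K then .output (some (v, w)) else findNegative K qs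
    | none => findNegative K qs

/-- The subroutine `BadCycle(s)`: perform `m` random walks of length `L` on the positive edges from
`s`, then query the full neighbourhood of every node in the set `K` of visited nodes, and return a
negative edge with both ends in `K` if there is one (the edge closes a bad cycle). -/
def badCycle {N d : ℕ} [NeZero d] (m L : ℕ) (s : Fin N) :
    QueryAlg N d (Option (Fin N × Fin N)) :=
  (walks L s m).bind fun l => findNegative l.dedup (l.dedup ×ˢ List.finRange d)

/-- The verdict of a tester. -/
inductive Verdict where
  | accept
  | reject

/-- The tester: `r` times, pick a uniformly random node `s` and run `BadCycle(s)`; reject if a bad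
cycle is found, and accept if this never happens. -/
def tester (N d : ℕ) [NeZero N] [NeZero d] (m L : ℕ) : (r : ℕ) → QueryAlg N d Verdict
  | 0 => .output .accept
  | r + 1 => .sample N fun s => (badCycle m L s).bind fun
    | some _ => .output .reject
    | none => tester N d m L r

/-- The number of starting nodes, `O(1/ε)`. -/
noncomputable def numStarts (C : ℕ) (ε : ℝ) : ℕ := ⌈(C : ℝ) / ε⌉₊

/-- The length of the walks: polynomial in `1/ε`, `d` and `log N`. -/
noncomputable def walkLength (C k N d : ℕ) (ε : ℝ) : ℕ :=
  ⌈(C : ℝ) * (d * (1 + Real.log N) / ε) ^ k⌉₊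

/-- The number of walks: `√N` times a polynomial in `1/ε`, `d` and `log N`. -/
noncomputable def numWalks (C k N d : ℕ) (ε : ℝ) : ℕ :=
  ⌈(C : ℝ) * √(N : ℝ) * (d * (1 + Real.log N) / ε) ^ k⌉₊

end ClusterTester

/-! One-sidedness: all visited nodes lie in one component of the positive edges. A negative edge
inside such a component contradicts every clustering and closes a bad cycle together with a positive
path.

Soundness: let `q` be the average of `P ^ j` over `j < T`, where `P` is the walk matrix and `T = L +
1`; row `s` is the law of the walk from `s` at a random time. `P` is symmetric and doubly
stochastic, hence so is `q`. (a) `P * q` and `q` differ only in the two end terms of the average, so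
replacing `q` by `P * q` gains only O(log(NT)/T) entropy per row. Row `v` of `P * q` is the `P
v`-average of the rows of `q`, so this gain is a Jensen gap of the entropy; it bounds Hellinger and
hence L1 distances. So on average the rows of `q` at the two ends of a positive edge are close in L1
(`sum_transition_mul_abs_sub_occupation_le`). (b) Threshold rounding: cutting a column of `q` at a
random level and peeling off the resulting sets one by one gives a partition. Its violated edges
number at most the L1 distances over positive edges, plus the overlaps `∑ s, min (q u s) (q v s)`
over negative edges, plus a small multiple of N (`exists_labelling`). (c) If `G` is far from
clusterable, (a) and (b) force the total overlap on negative edges to be at least εdN/2. By symmetry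
of `q` this is the sum over starting nodes `s` of the negative weight seen from `s`, so a random `s`
sees a lot of it with probability of order ε (`le_sum_negativeWeight`, `sum_failProb_le`). (d) From
such an `s`, a birthday argument works. Half of the walks collect lighter ends of negative edges,
and the other half then hits one of the matching heavier ends. About √N walks, up to factors
polynomial in d/ε, are enough (`failProb_le_of_negativeWeight`). -/

namespace QueryAlg

/-! ### Expectations, supports and query counts of randomized algorithms -/

variable {N d : ℕ} {α β : Type} (ans : Fin N → Fin d → Option (Fin N × SignType))

/-- The expectation of `f` over the output of an algorithm. -/
noncomputable def expect : QueryAlg N d α → (α → ℝ) → ℝ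
  | output a, f => f a
  | query v i next, f => (next (ans v i)).expect f
  | sample n next, f => (∑ j : Fin n, (next j).expect f) / n

theorem expect_bind (x : QueryAlg N d α) (g : α → QueryAlg N d β) (f : β → ℝ) :
    (x.bind g).expect ans f = x.expect ans fun a => (g a).expect ans f := by
  induction x with
  | output a => rfl
  | query v i next ih => exact ih _
  | sample n next ih => simp only [bind, expect, ih]

variable {ans} in
theorem expect_mono (x : QueryAlg N d α) {f g : α → ℝ} (h : ∀ a, f a ≤ g a) :
    x.expect ans f ≤ x.expect ans g := by
  induction x with
  | output a => exact h a
  | query v i next ih => exact ih _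
  | sample n next ih =>
    simp only [expect]
    gcongr
    exact ih _

theorem expect_const (x : QueryAlg N d α) (c : ℝ) : x.expect ans (fun _ => c) = c := by
  induction x with
  | output a => rfl
  | query v i next ih => exact ih _
  | sample n next ih =>
    have : (n : ℝ) ≠ 0 := Nat.cast_ne_zero.2 (NeZero.ne n)
    simp only [expect, ih]
    simp [this]

theorem expect_add (x : QueryAlg N d α) (f g : α → ℝ) :
    x.expect ans (fun a => f a + g a) = x.expect ans f + x.expect ans g := by
  induction x with
  | output a => rfl
  | query v i next ih => exact ih _
  | sample n next ih => simp only [expect, ih, Finset.sum_add_distrib, add_div]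

theorem expect_const_mul (x : QueryAlg N d α) (c : ℝ) (f : α → ℝ) :
    x.expect ans (fun a => c * f a) = c * x.expect ans f := by
  induction x with
  | output a => rfl
  | query v i next ih => exact ih _
  | sample n next ih => simp only [expect, ih, ← Finset.mul_sum, mul_div_assoc]

theorem expect_nonneg (x : QueryAlg N d α) {f : α → ℝ} (h : ∀ a, 0 ≤ f a) :
    0 ≤ x.expect ans f := by
  simpa only [expect_const] using x.expect_mono (ans := ans) h

-- The bridge from `PMF` to real expectations, in which all later estimates are made.
open Classical in
theorem eval_apply (x : QueryAlg N d α) (b : α) :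
    x.eval ans b = ENNReal.ofReal (x.expect ans fun a => if a = b then 1 else 0) := by
  induction x with
  | output a =>
    simp only [eval, expect, PMF.pure_apply, eq_comm]
    split_ifs <;> simp
  | query v i next ih => exact ih _
  | sample n next ih =>
    have hn : (0 : ℝ) < n := Nat.cast_pos.2 (NeZero.pos n)
    simp only [eval, expect, PMF.bind_apply, PMF.uniformOfFintype_apply, Fintype.card_fin, ih,
      tsum_fintype]
    rw [ENNReal.ofReal_div_of_pos hn, ENNReal.ofReal_sum_of_nonneg
      (fun j _ => expect_nonneg ans _ fun a => by split_ifs <;> norm_num), ← Finset.mul_sum,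
      ENNReal.ofReal_natCast, ENNReal.div_eq_inv_mul]

theorem eval_bind (x : QueryAlg N d α) (g : α → QueryAlg N d β) :
    (x.bind g).eval ans = (x.eval ans).bind fun a => (g a).eval ans := by
  induction x with
  | output a => simp [bind, eval]
  | query v i next ih => exact ih _
  | sample n next ih => simp only [bind, eval, ih, PMF.bind_bind]

theorem mem_support_bind (x : QueryAlg N d α) (g : α → QueryAlg N d β) (b : β) :
    b ∈ ((x.bind g).eval ans).support ↔
      ∃ a ∈ (x.eval ans).support, b ∈ ((g a).eval ans).support := by
  rw [eval_bind, PMF.mem_support_bind_iff]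

theorem mem_support_sample {n : ℕ} [NeZero n] (next : Fin n → QueryAlg N d α) (b : α) :
    b ∈ ((sample n next).eval ans).support ↔ ∃ j, b ∈ ((next j).eval ans).support := by
  simp [eval]

/-- The bound is required only on the support: the cost of the final queries of `badCycle` depends
on the length of the list of visited nodes, which is controlled only for lists that can occur. -/
theorem queryCount_bind_le (x : QueryAlg N d α) (g : α → QueryAlg N d β) (B : ℕ)
    (h : ∀ a ∈ (x.eval ans).support, (g a).queryCount ans ≤ B) :
    (x.bind g).queryCount ans ≤ x.queryCount ans + B := by
  induction x with
  | output a => simpa [bind, eval, queryCount] using h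
  | query v i next ih =>
    have := ih (ans v i) h
    simp only [bind, queryCount]
    omega
  | sample n next ih =>
    simp only [bind, queryCount]
    refine Finset.sup_le fun j _ => (ih j fun a ha => h a ?_).trans ?_
    · exact (mem_support_sample ans next a).2 ⟨j, ha⟩
    · gcongr
      exact Finset.le_sup (f := fun j => (next j).queryCount ans) (Finset.mem_univ j)

end QueryAlg

/-! ### One-sidedness, witnesses and the query bound -/

namespace ClusterTester

open QueryAlg

variable {N d : ℕ} {G : SignedGraph (Fin N)} (A : G.AdjList d)

theorem exists_answer_eq {v w : Fin N} (h : G.label v w ≠ 0) :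
    ∃ i : Fin d, A.answer v i = some (w, G.label v w) := by
  obtain ⟨j, hj⟩ := (A.nbr v).surjective ⟨w, h⟩
  refine ⟨⟨j, j.2.trans_le (A.degree_le v)⟩, ?_⟩
  simp [SignedGraph.AdjList.answer, hj]

theorem answer_eq_some {v w : Fin N} {i : Fin d} {σ : SignType}
    (h : A.answer v i = some (w, σ)) : σ = G.label v w ∧ G.label v w ≠ 0 := by
  unfold SignedGraph.AdjList.answer at h
  split_ifs at h with hi
  simp only [Option.some.injEq, Prod.mk.injEq] at h
  obtain ⟨rfl, rfl⟩ := h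
  exact ⟨rfl, ((A.nbr v) ⟨i, hi⟩).2⟩

/-- The node reached from `v` by a random walk step that draws the index `i`. -/
def step (v : Fin N) (i : Fin d) : Fin N :=
  match A.answer v i with
  | some (w, σ) => if σ = 1 then w else v
  | none => v

theorem walkStep_bind_step [NeZero d] {β : Type} (v : Fin N) (f : β → ℝ)
    (g : Fin N → QueryAlg N d β) :
    ((walkStep v).bind g).expect A.answer f =
      (∑ i : Fin d, (g (step A v i)).expect A.answer f) / d := by
  simp only [walkStep, QueryAlg.bind, expect]
  congr 1
  refine Finset.sum_congr rfl fun i _ => ?_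
  unfold step
  rcases A.answer v i with _ | ⟨w, σ⟩ <;> rfl

theorem mem_support_walkStep [NeZero d] {v w : Fin N}
    (h : w ∈ ((walkStep v : QueryAlg N d (Fin N)).eval A.answer).support) :
    w = v ∨ G.label v w = 1 := by
  obtain ⟨i, hi⟩ := (mem_support_sample _ _ _).1 h
  simp only [eval] at hi
  rcases hA : A.answer v i with _ | ⟨x, σ⟩
  · rw [hA] at hi
    left
    simpa [eval] using hi
  · rw [hA] at hi
    simp only [eval, PMF.support_pure, Set.mem_singleton_iff] at hi
    by_cases hs : σ = 1
    · rw [if_pos hs] at hi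
      subst hi
      exact Or.inr ((answer_eq_some A hA).1 ▸ hs)
    · rw [if_neg hs] at hi
      exact Or.inl hi

/-- Connectedness by a walk along positive edges. -/
def PosReachable (G : SignedGraph (Fin N)) : Fin N → Fin N → Prop :=
  Relation.ReflTransGen fun u v => G.label u v = 1

theorem PosReachable.symm {u v : Fin N} (h : PosReachable G u v) : PosReachable G v u := by
  have : Std.Symm fun u v => G.label u v = 1 := ⟨fun a b hab => by rw [G.symm]; exact hab⟩
  exact Std.Symm.symm (r := Relation.ReflTransGen fun u v => G.label u v = 1) _ _ h

theorem mem_support_walk [NeZero d] {L : ℕ} {s : Fin N} {l : List (Fin N)}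
    (h : l ∈ ((walk L s : QueryAlg N d _).eval A.answer).support) :
    l.length = L + 1 ∧ ∀ v ∈ l, PosReachable G s v := by
  induction L generalizing s l with
  | zero =>
    simp only [walk, eval, PMF.support_pure, Set.mem_singleton_iff] at h
    subst h
    exact ⟨rfl, fun v hv => List.mem_singleton.1 hv ▸ Relation.ReflTransGen.refl⟩
  | succ L ih =>
    obtain ⟨w, hw, h⟩ := (mem_support_bind _ _ _ _).1 h
    obtain ⟨l', hl', h⟩ := (mem_support_bind _ _ _ _).1 h
    simp only [eval, PMF.support_pure, Set.mem_singleton_iff] at h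
    subst h
    obtain ⟨h1, h2⟩ := ih hl'
    refine ⟨by simp [h1], ?_⟩
    simp only [List.mem_cons, forall_eq_or_imp]
    refine ⟨Relation.ReflTransGen.refl, fun v hv => ?_⟩
    rcases mem_support_walkStep A hw with rfl | hw
    · exact h2 v hv
    · exact Relation.ReflTransGen.head hw (h2 v hv)

theorem mem_support_walks [NeZero d] {L m : ℕ} {s : Fin N} {l : List (Fin N)}
    (h : l ∈ ((walks L s m : QueryAlg N d _).eval A.answer).support) :
    l.length = m * (L + 1) ∧ ∀ v ∈ l, PosReachable G s v := by
  induction m generalizing l with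
  | zero =>
    simp only [walks, eval, PMF.support_pure, Set.mem_singleton_iff] at h
    subst h
    simp
  | succ m ih =>
    obtain ⟨w, hw, h⟩ := (mem_support_bind _ _ _ _).1 h
    obtain ⟨l', hl', h⟩ := (mem_support_bind _ _ _ _).1 h
    simp only [eval, PMF.support_pure, Set.mem_singleton_iff] at h
    subst h
    obtain ⟨h1, h2⟩ := mem_support_walk A hw
    obtain ⟨h3, h4⟩ := ih hl'
    refine ⟨by rw [List.length_append, h1, h3]; ring, fun v hv => ?_⟩
    rcases List.mem_append.1 hv with hv | hv
    · exact h2 v hv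
    · exact h4 v hv

theorem mem_support_findNegative {K : List (Fin N)} {qs : List (Fin N × Fin d)} {u v : Fin N}
    (h : some (u, v) ∈ ((findNegative K qs).eval A.answer).support) :
    (∃ i, (u, i) ∈ qs) ∧ v ∈ K ∧ G.label u v = -1 := by
  induction qs with
  | nil => simp [findNegative, eval] at h
  | cons q qs ih =>
    obtain ⟨x, i⟩ := q
    have hrec (h : some (u, v) ∈ ((findNegative K qs).eval A.answer).support) :
        (∃ j, (u, j) ∈ (x, i) :: qs) ∧ v ∈ K ∧ G.label u v = -1 := by
      obtain ⟨⟨j, hj⟩, h⟩ := ih h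
      exact ⟨⟨j, List.mem_cons_of_mem _ hj⟩, h⟩
    simp only [findNegative, eval] at h
    rcases hA : A.answer x i with _ | ⟨w, σ⟩
    · rw [hA] at h
      exact hrec h
    · rw [hA] at h
      dsimp only at h
      split_ifs at h with hc
      · simp only [eval, PMF.support_pure, Set.mem_singleton_iff, Option.some.injEq,
          Prod.mk.injEq] at h
        obtain ⟨rfl, rfl⟩ := h
        exact ⟨⟨i, by simp⟩, hc.2, (answer_eq_some A hA).1 ▸ hc.1⟩
      · exact hrec h

theorem mem_support_badCycle [NeZero d] {m L : ℕ} {s u v : Fin N}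
    (h : some (u, v) ∈ ((badCycle m L s).eval A.answer).support) :
    G.label u v = -1 ∧ PosReachable G s u ∧ PosReachable G s v := by
  obtain ⟨l, hl, h⟩ := (mem_support_bind _ _ _ _).1 h
  obtain ⟨⟨i, hi⟩, hv, huv⟩ := mem_support_findNegative A h
  have hl := (mem_support_walks A hl).2
  have hu : u ∈ l.dedup := (List.mem_product.1 hi).1
  exact ⟨huv, hl u (List.mem_dedup.1 hu), hl v (List.mem_dedup.1 hv)⟩

theorem expect_findNegative_none {K : List (Fin N)} {qs : List (Fin N × Fin d)} {u v : Fin N}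
    {i : Fin d} (hu : (u, i) ∈ qs) (hv : v ∈ K) (h : A.answer u i = some (v, -1))
    (f : Option (Fin N × Fin N) → ℝ) (hf : ∀ e, f (some e) = 0) :
    (findNegative K qs).expect A.answer f = 0 := by
  induction qs with
  | nil => simp at hu
  | cons q qs ih =>
    obtain ⟨x, j⟩ := q
    simp only [findNegative, expect]
    rcases List.mem_cons.1 hu with hu | hu
    · obtain ⟨rfl, rfl⟩ := Prod.mk.inj hu
      simp [h, hv, expect, hf]
    · rcases A.answer x j with _ | ⟨w, σ⟩
      · exact ih hu
      · dsimp only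
        split_ifs
        · exact hf _
        · exact ih hu

/-- The probability that `BadCycle(s)` finds no bad cycle. -/
noncomputable def failProb [NeZero d] (m L : ℕ) (s : Fin N) : ℝ :=
  (badCycle m L s).expect A.answer fun o => if o = none then 1 else 0

open Classical in
theorem failProb_le [NeZero d] (m L : ℕ) (s : Fin N) :
    failProb A m L s ≤ (walks L s m).expect A.answer fun l =>
      if ∃ u ∈ l, ∃ v ∈ l, G.label u v = -1 then 0 else 1 := by
  rw [failProb, badCycle, expect_bind]
  refine expect_mono _ fun l => ?_
  split_ifs with h
  · obtain ⟨u, hu, v, hv, huv⟩ := h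
    obtain ⟨i, hi⟩ := exists_answer_eq A (v := u) (w := v) (by rw [huv]; decide)
    rw [huv] at hi
    refine (expect_findNegative_none A (i := i) ?_ (List.mem_dedup.2 hv) hi _ (by simp)).le
    exact List.mem_product.2 ⟨List.mem_dedup.2 hu, List.mem_finRange i⟩
  · calc _ ≤ (findNegative l.dedup (l.dedup ×ˢ List.finRange d)).expect A.answer fun _ => 1 :=
        expect_mono _ fun o => by split_ifs <;> norm_num
      _ = 1 := expect_const _ _ _

theorem failProb_nonneg [NeZero d] (m L : ℕ) (s : Fin N) : 0 ≤ failProb A m L s :=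
  expect_nonneg _ _ fun o => by split_ifs <;> norm_num

theorem failProb_le_one [NeZero d] (m L : ℕ) (s : Fin N) : failProb A m L s ≤ 1 :=
  (expect_mono _ fun o => by split_ifs <;> norm_num).trans_eq (expect_const A.answer _ 1)

-- The rounds are independent, and each draws its own starting node, so the failure probability
-- averaged over `s` is raised to the power `r`.
open Classical in
theorem expect_tester_accept [NeZero N] [NeZero d] (m L r : ℕ) :
    ((tester N d m L r).expect A.answer fun b => if b = .accept then 1 else 0) =
      ((∑ s, failProb A m L s) / N) ^ r := by
  induction r with
  | zero => simp [tester, expect]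
  | succ r ih =>
    rw [tester, expect, pow_succ', ← ih, div_mul_eq_mul_div, Finset.sum_mul]
    congr 1
    refine Finset.sum_congr rfl fun s _ => ?_
    rw [expect_bind, failProb, mul_comm, ← expect_const_mul]
    congr 1
    ext o
    rcases o with _ | e <;> simp [expect]

open Classical in
theorem eval_tester_reject [NeZero N] [NeZero d] (m L r : ℕ) :
    (tester N d m L r).eval A.answer .reject =
      ENNReal.ofReal (1 - ((∑ s, failProb A m L s) / N) ^ r) := by
  rw [eval_apply, ← expect_tester_accept]
  congr 1
  rw [eq_sub_iff_add_eq, ← expect_add]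
  refine Eq.trans ?_ (expect_const A.answer (tester N d m L r) 1)
  congr 1
  ext b
  cases b <;> simp

theorem queryCount_walkStep [NeZero d] (v : Fin N) :
    (walkStep v : QueryAlg N d _).queryCount A.answer ≤ 1 := by
  simp only [walkStep, queryCount]
  refine Finset.sup_le fun i _ => ?_
  rcases A.answer v i with _ | ⟨w, σ⟩ <;> simp [queryCount]

theorem queryCount_walk [NeZero d] (L : ℕ) (v : Fin N) :
    (walk L v : QueryAlg N d _).queryCount A.answer ≤ L := by
  induction L generalizing v with
  | zero => simp [walk, queryCount]
  | succ L ih =>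
    rw [walk]
    have := queryCount_walkStep A v
    refine (queryCount_bind_le _ _ _ L fun w _ => ?_).trans (by omega)
    exact (queryCount_bind_le _ _ _ 0 fun w _ => by simp [queryCount]).trans (ih w)

theorem queryCount_walks [NeZero d] (L m : ℕ) (v : Fin N) :
    (walks L v m : QueryAlg N d _).queryCount A.answer ≤ m * L := by
  induction m with
  | zero => simp [walks, queryCount]
  | succ m ih =>
    rw [walks]
    have := queryCount_walk A L v
    refine (queryCount_bind_le _ _ _ (m * L) fun w _ => ?_).trans (by rw [Nat.succ_mul]; omega)
    exact (queryCount_bind_le _ _ _ 0 fun w _ => by simp [queryCount]).trans ih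

theorem queryCount_findNegative (K : List (Fin N)) (qs : List (Fin N × Fin d)) :
    (findNegative K qs).queryCount A.answer ≤ qs.length := by
  induction qs with
  | nil => simp [findNegative, queryCount]
  | cons q qs ih =>
    simp only [findNegative, queryCount, List.length_cons]
    rcases A.answer q.1 q.2 with _ | ⟨w, σ⟩
    · dsimp only; omega
    · dsimp only
      split_ifs
      · simp [queryCount]
      · omega

theorem queryCount_badCycle [NeZero d] (m L : ℕ) (s : Fin N) :
    (badCycle m L s).queryCount A.answer ≤ m * (L + 1) * (d + 1) := by
  have h1 := queryCount_walks A L m s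
  refine (queryCount_bind_le _ _ _ (m * (L + 1) * d) fun l hl => ?_).trans (by nlinarith)
  refine (queryCount_findNegative A _ _).trans ?_
  rw [List.length_product, List.length_finRange, ← (mem_support_walks A hl).1]
  gcongr
  exact (List.dedup_sublist l).length_le

theorem queryCount_tester [NeZero N] [NeZero d] (m L r : ℕ) :
    (tester N d m L r).queryCount A.answer ≤ r * (m * (L + 1) * (d + 1)) := by
  induction r with
  | zero => simp [tester, queryCount]
  | succ r ih =>
    simp only [tester, queryCount]
    refine Finset.sup_le fun s _ => ?_
    have := queryCount_badCycle A m L s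
    refine (queryCount_bind_le _ _ _ (r * (m * (L + 1) * (d + 1))) fun o _ => ?_).trans
      (by rw [Nat.succ_mul]; omega)
    rcases o with _ | e
    · exact ih
    · simp [queryCount]

theorem eval_tester_accept_of_clusterable [NeZero N] [NeZero d] (hG : G.Clusterable)
    (m L r : ℕ) : (tester N d m L r).eval A.answer .accept = 1 := by
  rw [PMF.apply_eq_one_iff]
  obtain ⟨S, hpos, hneg⟩ := hG
  have hreach {u v : Fin N} (h : PosReachable G u v) : S u v := by
    induction h with
    | refl => exact S.refl _
    | tail _ h ih => exact S.trans ih (hpos _ _ h)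
  refine (PMF.support_nonempty _).subset_singleton_iff.1 fun b hb => ?_
  induction r with
  | zero => simpa [tester, eval] using hb
  | succ r ih =>
    obtain ⟨s, hs⟩ := (mem_support_sample _ _ _).1 hb
    obtain ⟨o, ho, hb⟩ := (mem_support_bind _ _ _ _).1 hs
    rcases o with _ | ⟨u, v⟩
    · exact ih hb
    · obtain ⟨huv, hu, hv⟩ := mem_support_badCycle A ho
      exact absurd (S.trans (S.symm (hreach hu)) (hreach hv)) (hneg u v huv)

/-- A positive path from `v` back to `u` is closed by the edge `u v`. Shortcutting the connecting
walk to a path keeps its edges positive, so the negative edge does not occur in it. -/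
theorem exists_isBadCycle {u v : Fin N} (huv : G.label u v = -1) (h : PosReachable G v u) :
    ∃ w : G.graph.Walk u u, G.IsBadCycle w ∧ s(u, v) ∈ w.edges := by
  have hadj : G.graph.Adj u v := show G.label u v ≠ 0 by rw [huv]; decide
  obtain ⟨w, hw⟩ : ∃ w : G.graph.Walk v u, ∀ e ∈ w.darts, G.label e.fst e.snd = 1 := by
    clear huv hadj
    induction h using Relation.ReflTransGen.head_induction_on with
    | refl => exact ⟨.nil, by simp⟩
    | head h _ ih =>
      obtain ⟨w, hw⟩ := ih
      refine ⟨.cons (show G.label _ _ ≠ 0 by rw [h]; decide) w, ?_⟩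
      intro e he
      rcases List.mem_cons.1 he with rfl | he
      · exact h
      · exact hw e he
  have hp : ∀ e ∈ w.bypass.darts, G.label e.fst e.snd = 1 :=
    fun e he => hw e (w.darts_bypass_subset_darts he)
  have hne : s(u, v) ∉ w.bypass.edges := by
    intro hmem
    obtain ⟨e, he, hee⟩ := List.mem_map.1 hmem
    have h1 := hp e he
    rcases SimpleGraph.dart_edge_eq_mk'_iff'.1 hee with ⟨h2, h3⟩ | ⟨h2, h3⟩
    · rw [h2, h3, huv] at h1
      exact absurd h1 (by decide)
    · rw [h2, h3, G.symm, huv] at h1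
      exact absurd h1 (by decide)
  refine ⟨.cons hadj w.bypass, ⟨?_, ?_⟩, by simp⟩
  · exact SimpleGraph.Walk.cons_isCycle_iff _ hadj |>.2 ⟨w.bypass_isPath, hne⟩
  · rw [SimpleGraph.Walk.darts_cons, List.countP_cons_of_pos (by simpa using huv),
      Nat.add_eq_right, List.countP_eq_zero]
    intro e he
    rw [hp e he]
    decide

end ClusterTester

/-! ### The transition matrix and occupation measures -/

namespace ClusterTester

open QueryAlg Matrix

variable {N d : ℕ} {G : SignedGraph (Fin N)} (A : G.AdjList d)

/-- The transition matrix of the random walk on the positive edges. -/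
noncomputable def transition (G : SignedGraph (Fin N)) (d : ℕ) : Matrix (Fin N) (Fin N) ℝ :=
  fun u v => (if G.label u v = 1 then (1 : ℝ) else 0) / d +
    if u = v then 1 - (∑ w, if G.label u w = 1 then (1 : ℝ) else 0) / d else 0

theorem transition_mulVec (f : Fin N → ℝ) (u : Fin N) :
    (transition G d *ᵥ f) u = (∑ w, if G.label u w = 1 then f w else 0) / d +
      (1 - (∑ w, if G.label u w = 1 then (1 : ℝ) else 0) / d) * f u := by
  simp only [mulVec, dotProduct, transition, add_mul, Finset.sum_add_distrib, ite_mul, zero_mul,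
    Finset.sum_ite_eq, Finset.mem_univ, if_true, Finset.sum_div, div_mul_eq_mul_div, one_mul]

/-- Averaging over the drawn index is applying the transition matrix: indices beyond the degree, and
indices of negative edges, both leave the walk at `u`. -/
theorem sum_step [NeZero d] (f : Fin N → ℝ) (u : Fin N) :
    (∑ i : Fin d, f (step A u i)) / d = (transition G d *ᵥ f) u := by
  have hd : (d : ℝ) ≠ 0 := Nat.cast_ne_zero.2 (NeZero.ne d)
  obtain ⟨e, he⟩ := Nat.exists_eq_add_of_le (A.degree_le u)
  have key : ∑ i : Fin d, f (step A u i) =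
      (∑ j : Fin (G.degree u), if G.label u (A.nbr u j).1 = 1 then f (A.nbr u j).1 else f u) +
        e * f u := by
    have hcast : ∑ i : Fin d, f (step A u i) =
        ∑ i : Fin (G.degree u + e), f (step A u (Fin.cast he.symm i)) :=
      (Equiv.sum_comp (finCongr he.symm) fun i => f (step A u i)).symm
    rw [hcast, Fin.sum_univ_add]
    congr 1
    · refine Finset.sum_congr rfl fun j _ => ?_
      simp only [step, SignedGraph.AdjList.answer, Fin.val_cast, Fin.val_castAdd, j.2, dite_true,
        Fin.eta]
      split_ifs <;> rfl
    · rw [← nsmul_eq_mul]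
      simp [step, SignedGraph.AdjList.answer]
  have hsum : (∑ j : Fin (G.degree u), if G.label u (A.nbr u j).1 = 1 then f (A.nbr u j).1 else f u)
      = ∑ w, if G.label u w ≠ 0 then (if G.label u w = 1 then f w else f u) else 0 := by
    rw [Equiv.sum_comp (A.nbr u) fun w => if G.label u w.1 = 1 then f w.1 else f u,
      ← Finset.sum_filter]
    exact (Finset.sum_subtype _ (by simp) fun w => if G.label u w = 1 then f w else f u).symm
  have hdeg : (G.degree u : ℝ) = ∑ w, if G.label u w ≠ 0 then (1 : ℝ) else 0 := by
    rw [SignedGraph.degree, Finset.sum_boole]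
  have hde : (d : ℝ) = G.degree u + e := by exact_mod_cast he
  have hsplit : (∑ w, if G.label u w ≠ 0 then (if G.label u w = 1 then f w else f u) else 0) =
      (∑ w, if G.label u w = 1 then f w else 0) + (∑ w, if G.label u w ≠ 0 then (1 : ℝ) else 0)
        * f u - (∑ w, if G.label u w = 1 then (1 : ℝ) else 0) * f u := by
    rw [Finset.sum_mul, Finset.sum_mul, ← Finset.sum_add_distrib, ← Finset.sum_sub_distrib]
    refine Finset.sum_congr rfl fun w _ => ?_
    by_cases h : G.label u w = 1
    · simp [h]
    · by_cases h0 : G.label u w = 0 <;> simp [h, h0]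
  rw [key, hsum, hsplit, transition_mulVec, ← hdeg]
  field_simp
  rw [hde]
  ring

theorem transition_isSymm : (transition G d).IsSymm := by
  ext u v
  simp only [transpose_apply, transition, G.symm v u]
  by_cases h : u = v
  · subst h; rfl
  · simp [h, Ne.symm h]

theorem transition_ge {u v : Fin N} (h : G.label u v = 1) :
    transition G d u v = 1 / d := by
  have : u ≠ v := by
    rintro rfl
    rw [G.loopless] at h
    exact absurd h (by decide)
  simp [transition, h, this]

theorem transition_nonneg [NeZero d] (A : G.AdjList d) (u v : Fin N) : 0 ≤ transition G d u v := by
  have h := sum_step A (Pi.single v 1) u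
  rw [mulVec_single_one] at h
  rw [← col_apply (transition G d), ← h]
  refine div_nonneg (Finset.sum_nonneg fun i _ => ?_) (Nat.cast_nonneg _)
  by_cases h : step A u i = v <;> simp [h]

theorem transition_row_sum (u : Fin N) : ∑ v, transition G d u v = 1 := by
  have := transition_mulVec (G := G) (d := d) (fun _ => 1) u
  simpa [mulVec, dotProduct] using this

/-- Row `s` is the distribution of a random walk from `s` at a uniformly random time below `T`. -/
noncomputable def occupation (G : SignedGraph (Fin N)) (d T : ℕ) : Matrix (Fin N) (Fin N) ℝ :=
  (T : ℝ)⁻¹ • ∑ j ∈ Finset.range T, transition G d ^ j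

theorem transition_pow_nonneg [NeZero d] (A : G.AdjList d) (j : ℕ) (u v : Fin N) :
    0 ≤ (transition G d ^ j) u v := by
  induction j generalizing u v with
  | zero =>
    rw [pow_zero, one_apply]
    split_ifs <;> norm_num
  | succ j ih =>
    rw [pow_succ, mul_apply]
    exact Finset.sum_nonneg fun w _ => mul_nonneg (ih u w) (transition_nonneg A w v)

theorem transition_pow_row_sum (j : ℕ) (u : Fin N) : ∑ v, (transition G d ^ j) u v = 1 := by
  have h : (transition G d ^ j) *ᵥ (fun _ => 1) = fun _ => 1 := by
    induction j with
    | zero => simp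
    | succ j ih =>
      rw [pow_succ, ← mulVec_mulVec]
      have : transition G d *ᵥ (fun _ => 1) = fun _ => 1 := by
        ext v
        simpa [mulVec, dotProduct] using transition_row_sum v
      rw [this, ih]
  simpa [mulVec, dotProduct] using congrFun h u

theorem occupation_apply (T : ℕ) (u v : Fin N) :
    occupation G d T u v = (T : ℝ)⁻¹ * ∑ j ∈ Finset.range T, (transition G d ^ j) u v := by
  rw [occupation, Matrix.smul_apply, Matrix.sum_apply, smul_eq_mul]

theorem occupation_symm (T : ℕ) (u v : Fin N) :
    occupation G d T u v = occupation G d T v u := by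
  rw [occupation_apply, occupation_apply]
  congr 1
  refine Finset.sum_congr rfl fun j _ => ?_
  exact ((transition_isSymm (G := G) (d := d)).pow j).apply _ _

theorem occupation_nonneg [NeZero d] (A : G.AdjList d) (T : ℕ) (u v : Fin N) : 0 ≤ occupation G d T u v := by
  rw [occupation_apply]
  exact mul_nonneg (by positivity) (Finset.sum_nonneg fun j _ => transition_pow_nonneg A j u v)

theorem occupation_row_sum {T : ℕ} (hT : T ≠ 0) (u : Fin N) :
    ∑ v, occupation G d T u v = 1 := by
  simp only [occupation_apply]
  rw [← Finset.mul_sum, Finset.sum_comm]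
  simp [transition_pow_row_sum, hT]

open Classical in
theorem transition_pow_le_expect_walk [NeZero d] (B : Finset (Fin N)) {j L : ℕ} (hj : j ≤ L)
    (s : Fin N) : ∑ v ∈ B, (transition G d ^ j) s v ≤
      (walk L s).expect A.answer fun l => if ∃ v ∈ l, v ∈ B then 1 else 0 := by
  induction L generalizing j s with
  | zero =>
    obtain rfl : j = 0 := by omega
    simp [walk, expect, one_apply]
  | succ L ih =>
    rw [walk, walkStep_bind_step]
    simp only [expect_bind, expect]
    rcases j with _ | j
    · simp only [pow_zero, one_apply, Finset.sum_ite_eq]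
      split_ifs with h
      · simp only [List.mem_cons, exists_eq_or_imp, h, true_or, if_true]
        simp [expect_const, NeZero.ne d]
      · exact div_nonneg (Finset.sum_nonneg fun i _ => expect_nonneg _ _ fun l => by
          split_ifs <;> norm_num) (Nat.cast_nonneg _)
    · have : ∑ v ∈ B, (transition G d ^ (j + 1)) s v =
          (∑ i : Fin d, ∑ v ∈ B, (transition G d ^ j) (step A s i) v) / d := by
        rw [sum_step A (fun w => ∑ v ∈ B, (transition G d ^ j) w v) s]
        simp only [pow_succ', mul_apply, mulVec, dotProduct, Finset.mul_sum]
        exact Finset.sum_comm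
      rw [this]
      gcongr with i
      refine (ih (by omega) _).trans (expect_mono _ fun l => ?_)
      split_ifs with h1 h2 h2
      · rfl
      · obtain ⟨v, hv, hB⟩ := h1
        exact absurd ⟨v, List.mem_cons_of_mem _ hv, hB⟩ h2
      · norm_num
      · rfl

-- Being in `B` at a fixed time up to `L` implies visiting `B`; averaging over the `L + 1` times 0,
-- …, `L` gives the occupation measure. This is the only fact about a single walk that the sampling
-- argument uses.
open Classical in
theorem occupation_le_expect_walk [NeZero d] (B : Finset (Fin N)) (L : ℕ) (s : Fin N) :
    ∑ v ∈ B, occupation G d (L + 1) s v ≤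
      (walk L s).expect A.answer fun l => if ∃ v ∈ l, v ∈ B then 1 else 0 := by
  simp only [occupation_apply]
  rw [← Finset.mul_sum, Finset.sum_comm, inv_mul_le_iff₀ (by positivity)]
  calc _ ≤ ∑ j ∈ Finset.range (L + 1),
        (walk L s).expect A.answer fun l => if ∃ v ∈ l, v ∈ B then 1 else 0 :=
        Finset.sum_le_sum fun j hj => transition_pow_le_expect_walk A B
          (by simpa [Nat.lt_succ_iff] using hj) s
    _ = _ := by simp

end ClusterTester

/-! ### Entropy: rows of the occupation matrix vary little along an average positive edge -/

section Entropy

open Real Matrix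

/-- Pointwise form of "squared Hellinger distance is at most relative entropy", from log t ≤ t − 1
at t = √b/√a. The terms `- a + b` cancel after averaging. -/
theorem sq_sqrt_sub_sqrt_le {a b : ℝ} (ha : 0 ≤ a) (hb : 0 ≤ b) (hab : b = 0 → a = 0) :
    (√a - √b) ^ 2 ≤ -negMulLog a - a * log b - a + b := by
  rcases ha.eq_or_lt with rfl | ha
  · simp [hb]
  have hb : 0 < b := hb.lt_of_ne fun h => ha.ne' (hab h.symm)
  obtain ⟨x, hx, rfl⟩ : ∃ x, 0 < x ∧ a = x ^ 2 := ⟨√a, sqrt_pos.2 ha, (sq_sqrt ha.le).symm⟩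
  obtain ⟨y, hy, rfl⟩ : ∃ y, 0 < y ∧ b = y ^ 2 := ⟨√b, sqrt_pos.2 hb, (sq_sqrt hb.le).symm⟩
  have h := log_le_sub_one_of_pos (div_pos hy hx)
  rw [log_div hy.ne' hx.ne'] at h
  have h2 : x ^ 2 * (log y - log x) ≤ x * y - x ^ 2 := by
    calc x ^ 2 * (log y - log x) ≤ x ^ 2 * (y / x - 1) := by gcongr
      _ = x * y - x ^ 2 := by field_simp
  rw [sqrt_sq hx.le, sqrt_sq hy.le, negMulLog, log_pow, log_pow]
  push_cast
  nlinarith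

/-- Factor a − b as (√a − √b)(√a + √b) and apply the weighted AM-GM inequality; the weight `c`
trades entropy gap against total mass. -/
theorem abs_sub_le_of_sqrt {a b c : ℝ} (ha : 0 ≤ a) (hb : 0 ≤ b) (hc : 0 < c) :
    |a - b| ≤ (2 * c)⁻¹ * (√a - √b) ^ 2 + c * (a + b) := by
  obtain ⟨x, hx, rfl⟩ : ∃ x, 0 ≤ x ∧ a = x ^ 2 := ⟨√a, sqrt_nonneg _, (sq_sqrt ha).symm⟩
  obtain ⟨y, hy, rfl⟩ : ∃ y, 0 ≤ y ∧ b = y ^ 2 := ⟨√b, sqrt_nonneg _, (sq_sqrt hb).symm⟩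
  rw [sqrt_sq hx, sqrt_sq hy, show x ^ 2 - y ^ 2 = (x - y) * (x + y) by ring, abs_mul,
    abs_of_nonneg (add_nonneg hx hy), ← sq_abs (x - y)]
  have h1 : (2 * c)⁻¹ * |x - y| ^ 2 + c / 2 * (x + y) ^ 2 - |x - y| * (x + y) =
      (2 * c)⁻¹ * (|x - y| - c * (x + y)) ^ 2 := by
    field_simp
    ring
  have h2 : 0 ≤ (2 * c)⁻¹ * (|x - y| - c * (x + y)) ^ 2 := by positivity
  nlinarith [mul_nonneg hc.le (sq_nonneg (x - y))]

theorem negMulLog_add_le {x y : ℝ} (hx : 0 ≤ x) (hy : 0 ≤ y) :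
    negMulLog (x + y) ≤ negMulLog x + negMulLog y := by
  have key {x y : ℝ} (hx : 0 ≤ x) (hy : 0 ≤ y) : x * log x ≤ x * log (x + y) := by
    rcases hx.eq_or_lt with rfl | hx
    · simp
    · exact mul_le_mul_of_nonneg_left (log_le_log hx (by linarith)) hx.le
  have h1 := key hx hy
  have h2 := key hy hx
  rw [add_comm y x] at h2
  simp only [negMulLog]
  linarith

theorem negMulLog_sub_negMulLog_add_le {c e : ℝ} (hc : 0 ≤ c) (he : 0 ≤ e) (h : c + e ≤ 1) :
    negMulLog c - negMulLog (c + e) ≤ e := by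
  have h1 : log (c + e) ≤ 0 := log_nonpos (by linarith) h
  rcases hc.eq_or_lt with rfl | hc
  · simp only [zero_add] at *
    simp only [negMulLog, neg_mul, zero_mul, neg_zero, zero_sub, neg_neg]
    nlinarith
  have h2 := log_le_sub_one_of_pos (div_pos (by linarith : 0 < c + e) hc)
  rw [log_div (by linarith) hc.ne'] at h2
  have h3 : c * (log (c + e) - log c) ≤ e := by
    calc _ ≤ c * ((c + e) / c - 1) := by gcongr
      _ = e := by field_simp; ring
  simp only [negMulLog]
  nlinarith

/-- The right side is the tangent at 1/a to the concave function −x log x. -/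
theorem negMulLog_le_mul_log_add {x a : ℝ} (hx : 0 ≤ x) (ha : 0 < a) :
    negMulLog x ≤ x * log a + a⁻¹ - x := by
  rcases hx.eq_or_lt with rfl | hx
  · simp [ha.le]
  have h := log_le_sub_one_of_pos (inv_pos.2 (mul_pos hx ha))
  rw [log_inv, log_mul hx.ne' ha.ne'] at h
  have h2 : x * (-(log x + log a)) ≤ a⁻¹ - x := by
    calc _ ≤ x * ((x * a)⁻¹ - 1) := by gcongr
      _ = a⁻¹ - x := by field_simp
  simp only [negMulLog]
  linarith

variable {V : Type} [Fintype V]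

/-- The Jensen gap of −x log x at the mean `b` is the average relative entropy of the `a u` against
`b`, so it controls the mean deviation. -/
theorem sum_mul_abs_sub_le {p a : V → ℝ} (hp : ∀ u, 0 ≤ p u) (hp1 : ∑ u, p u = 1)
    (ha : ∀ u, 0 ≤ a u) {b c : ℝ} (hb : ∑ u, p u * a u = b) (hc : 0 < c) :
    ∑ u, p u * |a u - b| ≤
      (2 * c)⁻¹ * (negMulLog b - ∑ u, p u * negMulLog (a u)) + 2 * c * b := by
  have hb0 : 0 ≤ b := hb ▸ Finset.sum_nonneg fun u _ => mul_nonneg (hp u) (ha u)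
  have hterm (u : V) : p u * |a u - b| ≤ p u * ((2 * c)⁻¹ *
      (-negMulLog (a u) - a u * log b - a u + b) + c * (a u + b)) := by
    -- Points of weight zero are set aside, because `b = 0` forces `a u = 0` only where `p u` is
    -- positive.
    rcases (hp u).eq_or_lt with h0 | hpos
    · simp [← h0]
    refine mul_le_mul_of_nonneg_left ((abs_sub_le_of_sqrt (ha u) hb0 hc).trans ?_) hpos.le
    gcongr
    refine sq_sqrt_sub_sqrt_le (ha u) hb0 fun h => ?_
    rw [h, Finset.sum_eq_zero_iff_of_nonneg fun u _ => mul_nonneg (hp u) (ha u)] at hb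
    exact (mul_eq_zero.1 (hb u (Finset.mem_univ u))).resolve_left hpos.ne'
  refine (Finset.sum_le_sum fun u _ => hterm u).trans_eq ?_
  have hexp (u : V) : p u * ((2 * c)⁻¹ * (-negMulLog (a u) - a u * log b - a u + b)
      + c * (a u + b)) = -(2 * c)⁻¹ * (p u * negMulLog (a u)) +
        ((2 * c)⁻¹ * (-log b - 1) + c) * (p u * a u) + ((2 * c)⁻¹ * b + c * b) * p u := by ring
  simp only [hexp, Finset.sum_add_distrib, ← Finset.mul_sum, hb, hp1]
  simp only [negMulLog]
  ring

variable {P q : Matrix V V ℝ}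

/-- Apply the Jensen gap bound at each entry of `P * q`. Since the columns of `P` sum to 1, the
averaged entropies of the rows of `q` add up to the total entropy of `q`, leaving exactly the
entropy gain of one step. -/
theorem sum_transition_mul_abs_sub_le (hP : ∀ u v, 0 ≤ P u v) (hrow : ∀ u, ∑ v, P u v = 1)
    (hcol : ∀ v, ∑ u, P u v = 1) (hq : ∀ u v, 0 ≤ q u v) (hqrow : ∀ u, ∑ v, q u v = 1)
    {c : ℝ} (hc : 0 < c) :
    ∑ v, ∑ u, P v u * ∑ s, |q u s - (P * q) v s| ≤
      (2 * c)⁻¹ * ∑ v, ∑ s, (negMulLog ((P * q) v s) - negMulLog (q v s)) +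
        2 * c * Fintype.card V := by
  have h1 (v s : V) := sum_mul_abs_sub_le (hP v) (hrow v) (fun u => hq u s)
    (b := (P * q) v s) (mul_apply).symm hc
  have hcolsum (f : V → ℝ) : ∑ v, ∑ u, P v u * f u = ∑ u, f u := by
    rw [Finset.sum_comm]
    simp only [← Finset.sum_mul, hcol, one_mul]
  calc ∑ v, ∑ u, P v u * ∑ s, |q u s - (P * q) v s|
      = ∑ v, ∑ s, ∑ u, P v u * |q u s - (P * q) v s| := by
        refine Finset.sum_congr rfl fun v _ => ?_
        simp only [Finset.mul_sum]
        exact Finset.sum_comm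
    _ ≤ ∑ v, ∑ s, ((2 * c)⁻¹ * (negMulLog ((P * q) v s) - ∑ u, P v u * negMulLog (q u s)) +
          2 * c * (P * q) v s) := Finset.sum_le_sum fun v _ => Finset.sum_le_sum fun s _ => h1 v s
    _ = _ := by
        have h2 : ∑ v, ∑ s, ∑ u, P v u * negMulLog (q u s) = ∑ v, ∑ s, negMulLog (q v s) := by
          rw [Finset.sum_comm, Finset.sum_congr rfl fun s _ => hcolsum fun u => negMulLog (q u s)]
          exact Finset.sum_comm
        have h3 : ∑ v, ∑ s, (P * q) v s = Fintype.card V := by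
          have (v : V) : ∑ s, (P * q) v s = 1 := by
            simp only [mul_apply]
            rw [Finset.sum_comm]
            simp only [← Finset.mul_sum, hqrow, mul_one, hrow]
          simp [this]
        simp only [Finset.sum_add_distrib, ← Finset.mul_sum, Finset.sum_sub_distrib, h2, h3]

variable [DecidableEq V]

/-- Telescoping: `q` and `P * q` share the powers 1, …, `T - 1` (part `c`) and differ only in `P ^ 0
/ T` (part `e`) against `P ^ T / T` (part `r`), each of row mass 1/T. Adding `r` creates at most its
own entropy, and removing `e` gains at most its mass. -/
theorem sum_negMulLog_occupation_le (hpow : ∀ j u v, 0 ≤ (P ^ j) u v)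
    (hpowrow : ∀ j u, ∑ v, (P ^ j) u v = 1) {T : ℕ} (hT : T ≠ 0)
    (hq : q = (T : ℝ)⁻¹ • ∑ j ∈ Finset.range T, P ^ j) (v : V) :
    ∑ s, (negMulLog ((P * q) v s) - negMulLog (q v s)) ≤
        (1 + log (Fintype.card V * T)) / T ∧
      ∑ s, |(P * q) v s - q v s| ≤ 2 / T := by
  obtain ⟨t, rfl⟩ := Nat.exists_eq_succ_of_ne_zero hT
  set τ : ℝ := ((t.succ : ℕ) : ℝ) with hτ
  have hτ0 : 0 < τ := by positivity
  set c : V → ℝ := fun s => τ⁻¹ * ∑ j ∈ Finset.range t, (P ^ (j + 1)) v s with hc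
  set e : V → ℝ := fun s => τ⁻¹ * (1 : Matrix V V ℝ) v s with he
  set r : V → ℝ := fun s => τ⁻¹ * (P ^ (t + 1)) v s with hr
  have hqv (s : V) : q v s = c s + e s := by
    rw [hq, Matrix.smul_apply, Matrix.sum_apply, Finset.sum_range_succ', smul_eq_mul, mul_add,
      pow_zero]
  have hPq (s : V) : (P * q) v s = c s + r s := by
    rw [hq, mul_smul_comm, Matrix.smul_apply, Finset.mul_sum, Matrix.sum_apply,
      Finset.sum_range_succ, smul_eq_mul, mul_add]
    simp only [← pow_succ', hc, hr]
  have hc0 (s : V) : 0 ≤ c s :=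
    mul_nonneg (by positivity) (Finset.sum_nonneg fun j _ => hpow _ _ _)
  have hone (s : V) : 0 ≤ (1 : Matrix V V ℝ) v s := by simpa using hpow 0 v s
  have he0 (s : V) : 0 ≤ e s := mul_nonneg (by positivity) (hone s)
  have hr0 (s : V) : 0 ≤ r s := mul_nonneg (by positivity) (hpow _ _ _)
  have hesum : ∑ s, e s = τ⁻¹ := by
    rw [← Finset.mul_sum, ← pow_zero P, hpowrow, mul_one]
  have hrsum : ∑ s, r s = τ⁻¹ := by
    rw [← Finset.mul_sum, hpowrow, mul_one]
  have hle (s : V) : c s + e s ≤ 1 := by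
    rw [← hqv]
    have h1 : ∑ s, q v s = 1 := by
      simp only [hq, Matrix.smul_apply, Matrix.sum_apply, smul_eq_mul]
      rw [← Finset.mul_sum, Finset.sum_comm]
      simp only [hpowrow, Finset.sum_const, Finset.card_range, nsmul_eq_mul, mul_one]
      exact inv_mul_cancel₀ hτ0.ne'
    rw [← h1]
    exact Finset.single_le_sum (f := fun s => q v s)
      (fun s _ => by rw [hqv]; exact add_nonneg (hc0 s) (he0 s)) (Finset.mem_univ s)
  have hcard : (0 : ℝ) < Fintype.card V := by
    exact_mod_cast Fintype.card_pos_iff.2 ⟨v⟩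
  constructor
  · calc ∑ s, (negMulLog ((P * q) v s) - negMulLog (q v s))
        ≤ ∑ s, (e s + (r s * log (Fintype.card V * τ) + (Fintype.card V * τ)⁻¹ - r s)) := by
          refine Finset.sum_le_sum fun s _ => ?_
          rw [hPq, hqv]
          have h1 := negMulLog_add_le (hc0 s) (hr0 s)
          have h2 := negMulLog_sub_negMulLog_add_le (hc0 s) (he0 s) (hle s)
          -- The tangent point 1/(|V|T) is the value that `r` would take if its mass were spread
          -- evenly.
          have h3 := negMulLog_le_mul_log_add (hr0 s) (mul_pos hcard hτ0)
          linarith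
      _ = (1 + log (Fintype.card V * τ)) / τ := by
          simp only [Finset.sum_add_distrib, Finset.sum_sub_distrib, ← Finset.sum_mul, hesum, hrsum,
            Finset.sum_const, Finset.card_univ, nsmul_eq_mul]
          field_simp
          ring
  · calc ∑ s, |(P * q) v s - q v s| ≤ ∑ s, (e s + r s) := by
          refine Finset.sum_le_sum fun s _ => ?_
          rw [hPq, hqv, abs_le]
          constructor <;> linarith [he0 s, hr0 s]
      _ = 2 / τ := by
          rw [Finset.sum_add_distrib, hesum, hrsum]
          ring

/-- Compare both rows with row `v` of `P * q` and use the triangle inequality. -/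
theorem sum_transition_mul_abs_sub_occupation_le (hP : ∀ u v, 0 ≤ P u v)
    (hcol : ∀ v, ∑ u, P u v = 1) (hpow : ∀ j u v, 0 ≤ (P ^ j) u v)
    (hpowrow : ∀ j u, ∑ v, (P ^ j) u v = 1) {T : ℕ} (hT : T ≠ 0)
    (hq : q = (T : ℝ)⁻¹ • ∑ j ∈ Finset.range T, P ^ j) {c : ℝ} (hc : 0 < c) :
    ∑ v, ∑ u, P v u * ∑ s, |q u s - q v s| ≤
      Fintype.card V * ((2 * c)⁻¹ * ((1 + log (Fintype.card V * T)) / T) + 2 * c + 2 / T) := by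
  have hrow (u : V) : ∑ v, P u v = 1 := by simpa using hpowrow 1 u
  have hT0 : (T : ℝ) ≠ 0 := Nat.cast_ne_zero.2 hT
  have hq0 (u v : V) : 0 ≤ q u v := by
    rw [hq, Matrix.smul_apply, Matrix.sum_apply, smul_eq_mul]
    exact mul_nonneg (by positivity) (Finset.sum_nonneg fun j _ => hpow j u v)
  have hqrow (u : V) : ∑ v, q u v = 1 := by
    simp only [hq, Matrix.smul_apply, Matrix.sum_apply, smul_eq_mul]
    rw [← Finset.mul_sum, Finset.sum_comm]
    simp [hpowrow, hT0]
  have h1 := sum_transition_mul_abs_sub_le hP hrow hcol hq0 hqrow hc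
  have h2 : ∑ v, ∑ s, (negMulLog ((P * q) v s) - negMulLog (q v s)) ≤
      Fintype.card V * ((1 + log (Fintype.card V * T)) / T) := by
    refine (Finset.sum_le_sum fun v _ =>
      (sum_negMulLog_occupation_le hpow hpowrow hT hq v).1).trans_eq ?_
    simp
  have h3 : ∑ v, ∑ s, |(P * q) v s - q v s| ≤ Fintype.card V * (2 / T) := by
    refine (Finset.sum_le_sum fun v _ =>
      (sum_negMulLog_occupation_le hpow hpowrow hT hq v).2).trans_eq ?_
    simp
  calc ∑ v, ∑ u, P v u * ∑ s, |q u s - q v s|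
      ≤ ∑ v, ∑ u, (P v u * ∑ s, |q u s - (P * q) v s| +
          P v u * ∑ s, |(P * q) v s - q v s|) := by
        refine Finset.sum_le_sum fun v _ => Finset.sum_le_sum fun u _ => ?_
        rw [← mul_add, ← Finset.sum_add_distrib]
        exact mul_le_mul_of_nonneg_left
          (Finset.sum_le_sum fun s _ => abs_sub_le _ _ _) (hP v u)
    _ = ∑ v, ∑ u, P v u * ∑ s, |q u s - (P * q) v s| + ∑ v, ∑ s, |(P * q) v s - q v s| := by
        simp only [Finset.sum_add_distrib, ← Finset.sum_mul, hrow, one_mul]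
    _ ≤ ((2 * c)⁻¹ * (Fintype.card V * ((1 + log (Fintype.card V * T)) / T)) +
          2 * c * Fintype.card V) + Fintype.card V * (2 / T) := by
        refine add_le_add (h1.trans ?_) h3
        gcongr
    _ = _ := by ring

end Entropy

/-! ### Rounding the occupation matrix to a partition -/

section Partition

open MeasureTheory

/-- `f` is integrable on the unit interval with integral `c`. -/
def HasUnitIntegral (f : ℝ → ℝ) (c : ℝ) : Prop :=
  IntegrableOn f (Set.Ico 0 1) ∧ ∫ θ in Set.Ico 0 1, f θ = c

namespace HasUnitIntegral

variable {f g : ℝ → ℝ} {a b : ℝ}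

theorem add (hf : HasUnitIntegral f a) (hg : HasUnitIntegral g b) :
    HasUnitIntegral (fun θ => f θ + g θ) (a + b) :=
  ⟨Integrable.add hf.1 hg.1, by rw [integral_add hf.1 hg.1, hf.2, hg.2]⟩

theorem sub (hf : HasUnitIntegral f a) (hg : HasUnitIntegral g b) :
    HasUnitIntegral (fun θ => f θ - g θ) (a - b) :=
  ⟨Integrable.sub hf.1 hg.1, by rw [integral_sub hf.1 hg.1, hf.2, hg.2]⟩

theorem const_mul (hf : HasUnitIntegral f a) (c : ℝ) :
    HasUnitIntegral (fun θ => c * f θ) (c * a) :=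
  ⟨Integrable.const_mul hf.1 c, by rw [integral_const_mul, hf.2]⟩

theorem sum {ι : Type} (s : Finset ι) {f : ι → ℝ → ℝ} {a : ι → ℝ}
    (hf : ∀ i ∈ s, HasUnitIntegral (f i) (a i)) :
    HasUnitIntegral (fun θ => ∑ i ∈ s, f i θ) (∑ i ∈ s, a i) :=
  ⟨integrable_finsetSum s fun i hi => (hf i hi).1, by
    rw [integral_finsetSum s fun i hi => (hf i hi).1]
    exact Finset.sum_congr rfl fun i hi => (hf i hi).2⟩

theorem mono (hf : HasUnitIntegral f a) (hg : HasUnitIntegral g b) (h : ∀ θ, 0 ≤ θ → f θ ≤ g θ) :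
    a ≤ b := by
  rw [← hf.2, ← hg.2]
  exact setIntegral_mono_on hf.1 hg.1 measurableSet_Ico fun θ hθ => h θ hθ.1

end HasUnitIntegral

theorem hasUnitIntegral_lt {a : ℝ} (h0 : 0 ≤ a) (h1 : a ≤ 1) :
    HasUnitIntegral (fun θ => if θ < a then 1 else 0) a := by
  have h : (fun θ : ℝ => if θ < a then (1 : ℝ) else 0) = (Set.Iio a).indicator 1 := by
    ext θ
    simp [Set.indicator_apply]
  have hI : Set.Iio a ∩ Set.Ico 0 1 = Set.Ico 0 a := by
    ext θ
    simp only [Set.mem_inter_iff, Set.mem_Iio, Set.mem_Ico]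
    constructor
    · rintro ⟨h2, h3, -⟩
      exact ⟨h3, h2⟩
    · rintro ⟨h2, h3⟩
      exact ⟨h3, h2, h3.trans_le h1⟩
  constructor
  · rw [h]
    refine IntegrableOn.indicator ?_ measurableSet_Iio
    exact integrableOn_const (by simp)
  · rw [h, integral_indicator_one measurableSet_Iio, measureReal_restrict_apply measurableSet_Iio,
      hI]
    simp [h0]

variable {V : Type} [Fintype V] [DecidableEq V]

/-- Take S = {v ∈ R : q v s > θ}, sum over `s` and integrate over θ in [0, 1). A positive edge is
cut with total weight equal to its L1 distance, and a negative edge lies inside S with weight equal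
to its overlap. An edge meets S with weight `∑ s, max`, which is at least 1, so charging only edges
that meet S covers the whole cost. The term with `δ` makes the comparison strict. -/
theorem exists_sparse_cluster {q : V → V → ℝ} (hq : ∀ v s, 0 ≤ q v s)
    (hq1 : ∀ v, ∑ s, q v s = 1) {δ : ℝ} (hδ : 0 < δ) {R : Finset V} (hR : R.Nonempty)
    (Pos Neg : Finset (V × V)) (hPos : ∀ p ∈ Pos, p.1 ∈ R ∧ p.2 ∈ R)
    (hNeg : ∀ p ∈ Neg, p.1 ∈ R ∧ p.2 ∈ R) :
    ∃ S ⊆ R, S.Nonempty ∧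
      ∑ p ∈ Pos, (if (p.1 ∈ S ↔ p.2 ∈ S) then 0 else 1) +
        ∑ p ∈ Neg, (if p.1 ∈ S ∧ p.2 ∈ S then 1 else 0) ≤
      ∑ p ∈ Pos, (∑ s, |q p.1 s - q p.2 s|) * (if p.1 ∈ S ∨ p.2 ∈ S then 1 else 0) +
        ∑ p ∈ Neg, (∑ s, min (q p.1 s) (q p.2 s)) * (if p.1 ∈ S ∨ p.2 ∈ S then 1 else 0) +
        δ * S.card := by
  by_contra! hcon
  set J : ℝ → ℝ → ℝ := fun a θ => if θ < a then 1 else 0 with hJ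
  have hle (v s : V) : q v s ≤ 1 :=
    hq1 v ▸ Finset.single_le_sum (fun s _ => hq v s) (Finset.mem_univ s)
  have hJv (v s : V) : HasUnitIntegral (J (q v s)) (q v s) := hasUnitIntegral_lt (hq v s) (hle v s)
  have hJmax (u v s : V) : HasUnitIntegral (J (max (q u s) (q v s))) (max (q u s) (q v s)) :=
    hasUnitIntegral_lt (le_max_of_le_left (hq u s)) (max_le (hle u s) (hle v s))
  have hJmin (u v s : V) : HasUnitIntegral (J (min (q u s) (q v s))) (min (q u s) (q v s)) :=
    hasUnitIntegral_lt (le_min (hq u s) (hq v s)) (min_le_of_left_le (hle u s))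
  have hL := HasUnitIntegral.sum Finset.univ fun s _ =>
    ((HasUnitIntegral.sum Pos fun p _ =>
        (hJmax p.1 p.2 s).const_mul (∑ s, |q p.1 s - q p.2 s|)).add
      (HasUnitIntegral.sum Neg fun p _ =>
        (hJmax p.1 p.2 s).const_mul (∑ s, min (q p.1 s) (q p.2 s)))).add
      ((HasUnitIntegral.sum R fun v _ => hJv v s).const_mul δ)
  have hU := HasUnitIntegral.sum Finset.univ fun s _ =>
    (HasUnitIntegral.sum Pos fun p _ => (hJmax p.1 p.2 s).sub (hJmin p.1 p.2 s)).add
      (HasUnitIntegral.sum Neg fun p _ => hJmin p.1 p.2 s)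
  have hcomp := hL.mono hU fun θ _ => by
    refine Finset.sum_le_sum fun s _ => ?_
    set S : Finset V := R.filter fun v => θ < q v s with hS
    have hmem {v : V} (hv : v ∈ R) : v ∈ S ↔ θ < q v s := by simp [hS, hv]
    have e1 : ∑ p ∈ Pos, (if (p.1 ∈ S ↔ p.2 ∈ S) then (0 : ℝ) else 1) =
        ∑ p ∈ Pos, (J (max (q p.1 s) (q p.2 s)) θ - J (min (q p.1 s) (q p.2 s)) θ) := by
      refine Finset.sum_congr rfl fun p hp => ?_
      simp only [hJ, hmem (hPos p hp).1, hmem (hPos p hp).2, lt_max_iff, lt_min_iff]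
      by_cases h1 : θ < q p.1 s <;> by_cases h2 : θ < q p.2 s <;> simp [h1, h2]
    have e2 : ∑ p ∈ Neg, (if p.1 ∈ S ∧ p.2 ∈ S then (1 : ℝ) else 0) =
        ∑ p ∈ Neg, J (min (q p.1 s) (q p.2 s)) θ := by
      refine Finset.sum_congr rfl fun p hp => ?_
      simp only [hJ, hmem (hNeg p hp).1, hmem (hNeg p hp).2, lt_min_iff]
    have e3 (c : V × V → ℝ) (E : Finset (V × V)) (hE : ∀ p ∈ E, p.1 ∈ R ∧ p.2 ∈ R) :
        ∑ p ∈ E, c p * (if p.1 ∈ S ∨ p.2 ∈ S then (1 : ℝ) else 0) =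
        ∑ p ∈ E, c p * J (max (q p.1 s) (q p.2 s)) θ := by
      refine Finset.sum_congr rfl fun p hp => ?_
      simp only [hJ, hmem (hE p hp).1, hmem (hE p hp).2, lt_max_iff]
    have e4 : (S.card : ℝ) = ∑ v ∈ R, J (q v s) θ := by
      rw [hS, hJ, Finset.sum_boole]
    rw [← e1, ← e2, ← e3 _ Pos hPos, ← e3 _ Neg hNeg, ← e4]
    rcases S.eq_empty_or_nonempty with h | h
    -- An empty level set costs nothing and is charged nothing, so only nonempty sets matter.
    · simp [h]
    · exact (hcon S (Finset.filter_subset _ _) h).le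
  have hmax (u v : V) : 1 ≤ ∑ s, max (q u s) (q v s) := by
    rw [← hq1 u]
    exact Finset.sum_le_sum fun s _ => le_max_left _ _
  have hlow {E : Finset (V × V)} {c : V × V → ℝ} (hc : ∀ p, 0 ≤ c p) :
      ∑ p ∈ E, c p ≤ ∑ s, ∑ p ∈ E, c p * max (q p.1 s) (q p.2 s) := by
    rw [Finset.sum_comm]
    refine Finset.sum_le_sum fun p _ => ?_
    rw [← Finset.mul_sum]
    exact le_mul_of_one_le_right (hc p) (hmax _ _)
  have hP := hlow (E := Pos) (c := fun p => ∑ s, |q p.1 s - q p.2 s|)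
    fun p => Finset.sum_nonneg fun s _ => abs_nonneg _
  have hN := hlow (E := Neg) (c := fun p => ∑ s, min (q p.1 s) (q p.2 s))
    fun p => Finset.sum_nonneg fun s _ => le_min (hq _ _) (hq _ _)
  have hRsum : ∑ s, ∑ v ∈ R, q v s = R.card := by
    rw [Finset.sum_comm]
    simp [hq1]
  have hPU : ∑ s, ∑ p ∈ Pos, (max (q p.1 s) (q p.2 s) - min (q p.1 s) (q p.2 s)) =
      ∑ p ∈ Pos, ∑ s, |q p.1 s - q p.2 s| := by
    rw [Finset.sum_comm]
    simp only [max_sub_min_eq_abs']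
  have hNU : ∑ s, ∑ p ∈ Neg, min (q p.1 s) (q p.2 s) =
      ∑ p ∈ Neg, ∑ s, min (q p.1 s) (q p.2 s) := Finset.sum_comm
  simp only [Finset.sum_add_distrib] at hcomp
  rw [← Finset.mul_sum, hRsum, hPU, hNU] at hcomp
  have : 0 < δ * R.card := mul_pos hδ (by exact_mod_cast hR.card_pos)
  linarith

/-- Peel off a sparse cluster and recurse on the remaining nodes. Each edge is charged once, when
its first end is removed, and each node pays `δ` once. -/
theorem exists_labelling_within {q : V → V → ℝ} (hq : ∀ v s, 0 ≤ q v s)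
    (hq1 : ∀ v, ∑ s, q v s = 1) {δ : ℝ} (hδ : 0 < δ) (Pos Neg : Finset (V × V)) (n : ℕ) :
    ∀ R : Finset V, R.card = n → ∃ π : V → ℕ,
      ∑ p ∈ Pos with p.1 ∈ R ∧ p.2 ∈ R, (if π p.1 = π p.2 then (0 : ℝ) else 1) +
        ∑ p ∈ Neg with p.1 ∈ R ∧ p.2 ∈ R, (if π p.1 = π p.2 then (1 : ℝ) else 0) ≤
      ∑ p ∈ Pos with p.1 ∈ R ∧ p.2 ∈ R, ∑ s, |q p.1 s - q p.2 s| +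
        ∑ p ∈ Neg with p.1 ∈ R ∧ p.2 ∈ R, ∑ s, min (q p.1 s) (q p.2 s) + δ * R.card := by
  induction n using Nat.strong_induction_on with
  | _ n ih =>
    intro R hn
    rcases R.eq_empty_or_nonempty with rfl | hR
    · exact ⟨fun _ => 0, by simp⟩
    obtain ⟨S, hSR, hS, hcost⟩ := exists_sparse_cluster hq hq1 hδ hR
      (Pos.filter fun p => p.1 ∈ R ∧ p.2 ∈ R) (Neg.filter fun p => p.1 ∈ R ∧ p.2 ∈ R)
      (fun p hp => (Finset.mem_filter.1 hp).2) (fun p hp => (Finset.mem_filter.1 hp).2)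
    have hcard : (R \ S).card + S.card = R.card := Finset.card_sdiff_add_card_eq_card hSR
    obtain ⟨π, hπ⟩ := ih (R \ S).card (by have := hS.card_pos; omega) (R \ S) rfl
    -- The shift by one keeps the new cluster apart from all later ones.
    refine ⟨fun v => if v ∈ S then 0 else π v + 1, ?_⟩
    have hcardR : (R.card : ℝ) = (R \ S).card + S.card := by exact_mod_cast hcard.symm
    have hsplit (E : Finset (V × V)) (c : V × V → ℝ) :
        ∑ p ∈ E with p.1 ∈ R ∧ p.2 ∈ R, c p =
          ∑ p ∈ E with p.1 ∈ R ∧ p.2 ∈ R, c p * (if p.1 ∈ S ∨ p.2 ∈ S then 1 else 0) +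
            ∑ p ∈ E with p.1 ∈ R \ S ∧ p.2 ∈ R \ S, c p := by
      simp only [Finset.sum_filter]
      rw [← Finset.sum_add_distrib]
      refine Finset.sum_congr rfl fun p _ => ?_
      by_cases h1 : p.1 ∈ R <;> by_cases h2 : p.2 ∈ R <;> by_cases h3 : p.1 ∈ S <;>
        by_cases h4 : p.2 ∈ S <;> simp [h1, h2, h3, h4]
    have hpos : ∑ p ∈ Pos with p.1 ∈ R ∧ p.2 ∈ R,
        (if (if p.1 ∈ S then 0 else π p.1 + 1) = (if p.2 ∈ S then 0 else π p.2 + 1)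
          then (0 : ℝ) else 1) =
        ∑ p ∈ Pos with p.1 ∈ R ∧ p.2 ∈ R, (if (p.1 ∈ S ↔ p.2 ∈ S) then 0 else 1) +
          ∑ p ∈ Pos with p.1 ∈ R \ S ∧ p.2 ∈ R \ S, (if π p.1 = π p.2 then (0 : ℝ) else 1) := by
      simp only [Finset.sum_filter]
      rw [← Finset.sum_add_distrib]
      refine Finset.sum_congr rfl fun p _ => ?_
      by_cases h1 : p.1 ∈ R <;> by_cases h2 : p.2 ∈ R <;> by_cases h3 : p.1 ∈ S <;>
        by_cases h4 : p.2 ∈ S <;> simp [h1, h2, h3, h4]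
    have hneg : ∑ p ∈ Neg with p.1 ∈ R ∧ p.2 ∈ R,
        (if (if p.1 ∈ S then 0 else π p.1 + 1) = (if p.2 ∈ S then 0 else π p.2 + 1)
          then (1 : ℝ) else 0) =
        ∑ p ∈ Neg with p.1 ∈ R ∧ p.2 ∈ R, (if p.1 ∈ S ∧ p.2 ∈ S then 1 else 0) +
          ∑ p ∈ Neg with p.1 ∈ R \ S ∧ p.2 ∈ R \ S, (if π p.1 = π p.2 then (1 : ℝ) else 0) := by
      simp only [Finset.sum_filter]
      rw [← Finset.sum_add_distrib]
      refine Finset.sum_congr rfl fun p _ => ?_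
      by_cases h1 : p.1 ∈ R <;> by_cases h2 : p.2 ∈ R <;> by_cases h3 : p.1 ∈ S <;>
        by_cases h4 : p.2 ∈ S <;> simp [h1, h2, h3, h4]
    rw [hpos, hneg, hsplit Pos fun p => ∑ s, |q p.1 s - q p.2 s|,
      hsplit Neg fun p => ∑ s, min (q p.1 s) (q p.2 s), hcardR]
    linarith

theorem exists_labelling {q : V → V → ℝ} (hq : ∀ v s, 0 ≤ q v s)
    (hq1 : ∀ v, ∑ s, q v s = 1) {δ : ℝ} (hδ : 0 < δ) (Pos Neg : Finset (V × V)) :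
    ∃ π : V → ℕ,
      ∑ p ∈ Pos, (if π p.1 = π p.2 then (0 : ℝ) else 1) +
        ∑ p ∈ Neg, (if π p.1 = π p.2 then (1 : ℝ) else 0) ≤
      ∑ p ∈ Pos, ∑ s, |q p.1 s - q p.2 s| +
        ∑ p ∈ Neg, ∑ s, min (q p.1 s) (q p.2 s) + δ * Fintype.card V := by
  simpa using exists_labelling_within hq hq1 hδ Pos Neg _ Finset.univ rfl

end Partition

/-! ### From labellings of the nodes to edge modifications -/

namespace SignedGraph

variable {N d : ℕ} {G : SignedGraph (Fin N)}

/-- The pairs `u < v` of nodes joined by an edge of sign `σ`. -/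
def edgePairs (G : SignedGraph (Fin N)) (σ : SignType) : Finset (Fin N × Fin N) :=
  Finset.univ.filter fun p => p.1 < p.2 ∧ G.label p.1 p.2 = σ

/-- The graph obtained by deleting all edges that contradict a labelling of the nodes. -/
def repair (G : SignedGraph (Fin N)) (π : Fin N → ℕ) : SignedGraph (Fin N) where
  label u v := if (π u = π v ∧ G.label u v = -1) ∨ (π u ≠ π v ∧ G.label u v = 1) then 0
    else G.label u v
  symm u v := by simp only [G.symm v u, eq_comm (a := π u), ne_eq]
  loopless v := by simp [G.loopless]

theorem repair_clusterable (G : SignedGraph (Fin N)) (π : Fin N → ℕ) :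
    (G.repair π).Clusterable := by
  refine ⟨Setoid.comap π ⊥, fun u v h => ?_, fun u v h => ?_⟩
  · change π u = π v
    by_contra hne
    by_cases h1 : G.label u v = 1 <;> simp [repair, hne, h1] at h
  · change ¬ π u = π v
    intro he
    by_cases h1 : G.label u v = -1 <;> simp [repair, he, h1] at h

theorem editDistance_repair_le (G : SignedGraph (Fin N)) (π : Fin N → ℕ) :
    (G.editDistance (G.repair π) : ℝ) ≤
      ∑ p ∈ G.edgePairs 1, (if π p.1 = π p.2 then (0 : ℝ) else 1) +
        ∑ p ∈ G.edgePairs (-1), (if π p.1 = π p.2 then (1 : ℝ) else 0) := by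
  rw [editDistance, Finset.card_eq_sum_ones]
  push_cast
  simp only [edgePairs, Finset.sum_filter]
  rw [← Finset.sum_add_distrib]
  refine Finset.sum_le_sum fun p _ => ?_
  have hσ : ∀ σ : SignType, σ = 0 ∨ σ = 1 ∨ σ = -1 := by decide
  by_cases h1 : p.1 < p.2 <;> by_cases h2 : π p.1 = π p.2 <;>
    rcases hσ (G.label p.1 p.2) with h | h | h <;> simp [repair, h1, h2, h]

theorem sum_edgePairs_le (σ : SignType) {g : Fin N → Fin N → ℝ} (hg : ∀ u v, 0 ≤ g u v) :
    ∑ p ∈ G.edgePairs σ, (g p.1 p.2 + g p.2 p.1) ≤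
      ∑ u, ∑ v, if G.label u v = σ then g u v else 0 := by
  have h1 : ∑ p ∈ G.edgePairs σ, g p.1 p.2 =
      ∑ u, ∑ v, if u < v ∧ G.label u v = σ then g u v else 0 := by
    rw [edgePairs, Finset.sum_filter, Fintype.sum_prod_type]
  have h2 : ∑ p ∈ G.edgePairs σ, g p.2 p.1 =
      ∑ u, ∑ v, if v < u ∧ G.label u v = σ then g u v else 0 := by
    rw [edgePairs, Finset.sum_filter, Fintype.sum_prod_type_right]
    simp only [G.symm]
  rw [Finset.sum_add_distrib, h1, h2, ← Finset.sum_add_distrib]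
  refine Finset.sum_le_sum fun u _ => ?_
  rw [← Finset.sum_add_distrib]
  refine Finset.sum_le_sum fun v _ => ?_
  by_cases h : G.label u v = σ
  · rcases lt_trichotomy u v with h3 | h3 | h3
    · simp [h, h3, h3.not_gt]
    · simp only [h3, lt_irrefl, false_and, if_false, add_zero]
      split_ifs <;> simp [hg]
    · simp [h, h3, h3.not_gt]
  · simp [h]

theorem sum_label_eq_le (A : G.AdjList d) {σ : SignType} (hσ : σ ≠ 0) (u : Fin N) :
    (∑ v, if G.label u v = σ then (1 : ℝ) else 0) ≤ d := by
  rw [Finset.sum_boole]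
  norm_cast
  refine (Finset.card_le_card fun v hv => ?_).trans (A.degree_le u)
  rw [Finset.mem_filter] at hv ⊢
  exact ⟨hv.1, hv.2 ▸ hσ⟩

end SignedGraph

/-! ### Two-phase sampling from a good starting node -/

namespace ClusterTester

open QueryAlg

variable {N d : ℕ} {G : SignedGraph (Fin N)} (A : G.AdjList d)

theorem expect_walks_add [NeZero d] (L : ℕ) (s : Fin N) (a b : ℕ) (f : List (Fin N) → ℝ) :
    (walks L s (a + b)).expect A.answer f = (walks L s a).expect A.answer fun l =>
      (walks L s b).expect A.answer fun l' => f (l ++ l') := by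
  induction a generalizing f with
  | zero => simp [walks, expect]
  | succ a ih => simp only [Nat.succ_add, walks, expect_bind, expect, ih, List.append_assoc]

/-- The weight of the negative edges seen from `s`: an edge weighs as much as its lighter end. -/
noncomputable def negativeWeight (G : SignedGraph (Fin N)) (q : Fin N → ℝ) : ℝ :=
  ∑ p ∈ G.edgePairs (-1), min (q p.1) (q p.2)

-- Charge each negative edge to an end of smaller mass; a node is charged at most `d` times.
open Classical in
theorem negativeWeight_le {q : Fin N → ℝ} (A : G.AdjList d) (hq : ∀ v, 0 ≤ q v) :
    negativeWeight G q ≤ d * ∑ u with ∃ v, G.label u v = -1 ∧ q u ≤ q v, q u := by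
  calc negativeWeight G q
      ≤ ∑ p ∈ G.edgePairs (-1), ((if q p.1 ≤ q p.2 then q p.1 else 0) +
          if q p.2 ≤ q p.1 then q p.2 else 0) := by
        refine Finset.sum_le_sum fun p _ => ?_
        rcases le_total (q p.1) (q p.2) with h | h
        · simp only [h, min_eq_left, if_true]
          split_ifs <;> linarith [hq p.2]
        · simp only [h, min_eq_right, if_true]
          split_ifs <;> linarith [hq p.1]
    _ ≤ ∑ u, ∑ v, if G.label u v = -1 then (if q u ≤ q v then q u else 0) else 0 :=
        G.sum_edgePairs_le (-1) (g := fun u v => if q u ≤ q v then q u else 0)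
          fun u v => by split_ifs <;> simp [hq]
    _ ≤ ∑ u, if ∃ v, G.label u v = -1 ∧ q u ≤ q v then d * q u else 0 := by
        refine Finset.sum_le_sum fun u _ => ?_
        split_ifs with h
        · calc _ ≤ ∑ v, (if G.label u v = -1 then (1 : ℝ) else 0) * q u := by
                refine Finset.sum_le_sum fun v _ => ?_
                split_ifs <;> simp [hq]
            _ ≤ d * q u := by
                rw [← Finset.sum_mul]
                exact mul_le_mul_of_nonneg_right (G.sum_label_eq_le A (by decide) u) (hq u)
        · refine (Finset.sum_eq_zero fun v _ => ?_).le
          push Not at h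
          split_ifs with h1 h2
          · exact absurd h2 (h v h1).not_ge
          · rfl
          · rfl
    _ = _ := by rw [Finset.mul_sum, Finset.sum_filter]

section Sampling

variable [NeZero d] {L : ℕ} {s : Fin N} {q : Fin N → ℝ}

open Classical in
theorem expect_walks_avoid_le (B : Finset (Fin N))
    (hhit : ∑ v ∈ B, q v ≤
      (walk L s).expect A.answer fun l => if ∃ v ∈ l, v ∈ B then 1 else 0) (m : ℕ) :
    ((walks L s m).expect A.answer fun l => if ∃ v ∈ l, v ∈ B then 0 else 1) ≤
      (1 - ∑ v ∈ B, q v) ^ m := by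
  have hcompl : ((walk L s).expect A.answer fun l => if ∃ v ∈ l, v ∈ B then 0 else 1) ≤
      1 - ∑ v ∈ B, q v := by
    refine le_sub_iff_add_le.2 ((add_le_add_right hhit _).trans_eq ?_)
    rw [← expect_add]
    refine Eq.trans ?_ (expect_const A.answer (walk L s) 1)
    congr 1
    ext l
    split_ifs <;> norm_num
  induction m with
  | zero => simp [walks, expect]
  | succ m ih =>
    simp only [walks, expect_bind, expect]
    have hmul (l l' : List (Fin N)) : (if ∃ v ∈ l ++ l', v ∈ B then (0 : ℝ) else 1) =
        (if ∃ v ∈ l, v ∈ B then 0 else 1) * (if ∃ v ∈ l', v ∈ B then 0 else 1) := by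
      simp only [List.mem_append, or_and_right, exists_or]
      by_cases h1 : ∃ v ∈ l, v ∈ B <;> by_cases h2 : ∃ v ∈ l', v ∈ B <;> simp [h1, h2]
    simp only [hmul, expect_const_mul]
    simp only [mul_comm _ (expect A.answer (walks L s m) _), expect_const_mul]
    rw [pow_succ]
    have h0 : 0 ≤ (walk L s).expect A.answer fun l => if ∃ v ∈ l, v ∈ B then (0 : ℝ) else 1 :=
      expect_nonneg _ _ fun l => by split_ifs <;> norm_num
    exact mul_le_mul ih hcompl h0 (pow_nonneg (h0.trans hcompl) _)

-- Exponential potential of the mass of `U` collected so far. While less than `γ` is collected, at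
-- least `γ` of `U` is unseen, so a walk gains at least `κ` with probability at least `γ`, which
-- shrinks the expected potential by a fixed factor. Once `γ` is collected, the second term
-- suffices. The already visited list `K` is general for the induction.
open Classical in
theorem expect_exp_mass_le (hq : ∀ v, 0 ≤ q v)
    (hhit : ∀ B : Finset (Fin N), ∑ v ∈ B, q v ≤
      (walk L s).expect A.answer fun l => if ∃ v ∈ l, v ∈ B then 1 else 0)
    {U : Finset (Fin N)} {κ γ M : ℝ} (hM : 0 ≤ M) (hκ : 0 ≤ κ) (hγ : 0 ≤ γ) (hγ1 : γ ≤ 1)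
    (hUκ : ∀ v ∈ U, κ ≤ q v) (hUγ : 2 * γ ≤ ∑ v ∈ U, q v) (m : ℕ) (K : List (Fin N)) :
    ((walks L s m).expect A.answer fun l => Real.exp (-M * ∑ v ∈ U with v ∈ K ++ l, q v)) ≤
      (1 - γ * (1 - Real.exp (-M * κ))) ^ m * Real.exp (-M * ∑ v ∈ U with v ∈ K, q v) +
        Real.exp (-M * γ) := by
  have he1 : Real.exp (-M * κ) ≤ 1 := Real.exp_le_one_iff.2 (by nlinarith)
  have he0 := Real.exp_pos (-M * κ)
  have hρ : 0 ≤ 1 - γ * (1 - Real.exp (-M * κ)) := by nlinarith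
  induction m generalizing K with
  | zero => simp [walks, expect, (Real.exp_pos _).le]
  | succ m ih =>
    have hmono (K l : List (Fin N)) :
        ∑ v ∈ U with v ∈ K, q v ≤ ∑ v ∈ U with v ∈ K ++ l, q v := by
      refine Finset.sum_le_sum_of_subset_of_nonneg (fun v hv => ?_) fun v _ _ => hq v
      rw [Finset.mem_filter] at hv ⊢
      exact ⟨hv.1, List.mem_append_left _ hv.2⟩
    by_cases hK : γ ≤ ∑ v ∈ U with v ∈ K, q v
    · refine le_add_of_nonneg_of_le (by positivity) ?_
      calc _ ≤ (walks L s (m + 1)).expect A.answer fun _ => Real.exp (-M * γ) := by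
            refine expect_mono _ fun l => Real.exp_le_exp.2 ?_
            have := hK.trans (hmono K l)
            nlinarith
        _ = _ := expect_const _ _ _
    push Not at hK
    simp only [walks, expect_bind, expect, ← List.append_assoc]
    have hstep (l : List (Fin N)) : Real.exp (-M * ∑ v ∈ U with v ∈ K ++ l, q v) ≤
        Real.exp (-M * ∑ v ∈ U with v ∈ K, q v) + (-(Real.exp (-M * ∑ v ∈ U with v ∈ K, q v) *
          (1 - Real.exp (-M * κ)))) *
            (if ∃ v ∈ l, v ∈ U.filter fun v => v ∉ K then 1 else 0) := by
      split_ifs with h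
      · obtain ⟨v, hv, hvU⟩ := h
        rw [Finset.mem_filter] at hvU
        have : ∑ v ∈ U with v ∈ K, q v + κ ≤ ∑ v ∈ U with v ∈ K ++ l, q v := by
          have hnot : v ∉ U.filter fun v => v ∈ K := by simp [hvU.2]
          calc _ ≤ ∑ v ∈ U with v ∈ K, q v + q v := by gcongr; exact hUκ v hvU.1
            _ = ∑ x ∈ insert v (U.filter fun v => v ∈ K), q x := by
                rw [Finset.sum_insert hnot, add_comm]
            _ ≤ _ := by
                refine Finset.sum_le_sum_of_subset_of_nonneg (fun x hx => ?_) fun v _ _ => hq v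
                rw [Finset.mem_filter, List.mem_append]
                rcases Finset.mem_insert.1 hx with rfl | hx
                · exact ⟨hvU.1, Or.inr hv⟩
                · rw [Finset.mem_filter] at hx
                  exact ⟨hx.1, Or.inl hx.2⟩
        calc _ ≤ Real.exp (-M * ∑ v ∈ U with v ∈ K, q v + -M * κ) :=
              Real.exp_le_exp.2 (by nlinarith)
          _ = _ := by rw [Real.exp_add]; ring
      · rw [mul_zero, add_zero]
        have := hmono K l
        exact Real.exp_le_exp.2 (by nlinarith)
    have hrest : γ ≤ ∑ v ∈ U with v ∉ K, q v := by
      have := Finset.sum_filter_add_sum_filter_not U (fun v => v ∈ K) q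
      linarith
    have hone : ((walk L s).expect A.answer fun l =>
        Real.exp (-M * ∑ v ∈ U with v ∈ K ++ l, q v)) ≤
        Real.exp (-M * ∑ v ∈ U with v ∈ K, q v) * (1 - γ * (1 - Real.exp (-M * κ))) := by
      refine (expect_mono _ hstep).trans ?_
      rw [expect_add, expect_const_mul, expect_const]
      have h1 := hrest.trans (hhit _)
      have h2 : 0 ≤ Real.exp (-M * ∑ v ∈ U with v ∈ K, q v) * (1 - Real.exp (-M * κ)) :=
        mul_nonneg (Real.exp_pos _).le (by linarith)
      have h3 := mul_le_mul_of_nonneg_left h1 h2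
      linarith
    refine (expect_mono _ fun l => ih (K ++ l)).trans ?_
    rw [expect_add, expect_const_mul, expect_const, pow_succ]
    have := mul_le_mul_of_nonneg_left hone (pow_nonneg hρ m)
    linarith

/-- The first `a` walks collect lighter ends of negative edges; the last `b` must then avoid the
heavier partners of those ends. The partners carry at least a 1/d fraction of the collected mass, so
avoidance has probability at most exp(−(b/d) · collected mass), the potential bounded above. -/
theorem failProb_le_of_negativeWeight [NeZero N] (hq : ∀ v, 0 ≤ q v)
    (hq1 : ∑ v, q v = 1)
    (hhit : ∀ B : Finset (Fin N), ∑ v ∈ B, q v ≤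
      (walk L s).expect A.answer fun l => open Classical in if ∃ v ∈ l, v ∈ B then 1 else 0)
    {γ : ℝ} (hγ : 0 ≤ γ) (hW : 4 * γ * d ≤ negativeWeight G q) (a b : ℕ) :
    failProb A (a + b) L s ≤
      (1 - γ * (1 - Real.exp (-(b / d) * (2 * γ / N)))) ^ a + Real.exp (-(b / d) * γ) := by
  classical
  have hd : (0 : ℝ) < d := Nat.cast_pos.2 (NeZero.pos d)
  have hN : (0 : ℝ) < N := Nat.cast_pos.2 (NeZero.pos N)
  set U₀ : Finset (Fin N) := Finset.univ.filter fun u => ∃ v, G.label u v = -1 ∧ q u ≤ q v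
  -- Nodes below 2γ/N carry at most 2γ in total, so discarding them keeps half of the mass 4γ and
  -- gives every remaining node the minimal gain `κ`.
  set U : Finset (Fin N) := U₀.filter fun u => 2 * γ / N ≤ q u with hU
  have hU₀ : 4 * γ ≤ ∑ u ∈ U₀, q u := by
    have := hW.trans (negativeWeight_le A hq)
    rw [mul_comm _ (d : ℝ)] at this
    exact le_of_mul_le_mul_left this hd
  have hlight : ∑ u ∈ U₀ with ¬ 2 * γ / N ≤ q u, q u ≤ 2 * γ := by
    calc _ ≤ ∑ u ∈ U₀ with ¬ 2 * γ / N ≤ q u, 2 * γ / N :=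
          Finset.sum_le_sum fun u hu => (not_le.1 (Finset.mem_filter.1 hu).2).le
      _ ≤ ∑ _u : Fin N, 2 * γ / N :=
          Finset.sum_le_sum_of_subset_of_nonneg (Finset.subset_univ _) fun _ _ _ => by positivity
      _ = 2 * γ := by
          simp only [Finset.sum_const, Finset.card_univ, Fintype.card_fin, nsmul_eq_mul]
          field_simp
  have hUγ : 2 * γ ≤ ∑ u ∈ U, q u := by
    have := Finset.sum_filter_add_sum_filter_not U₀ (fun u => 2 * γ / N ≤ q u) q
    linarith
  have hγ1 : γ ≤ 1 := by
    have := Finset.sum_le_sum_of_subset_of_nonneg (Finset.subset_univ U) fun v _ _ => hq v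
    linarith
  have hpartner (u : Fin N) : ∃ v, u ∈ U → G.label u v = -1 ∧ q u ≤ q v := by
    by_cases hu : u ∈ U
    · obtain ⟨v, hv⟩ := (Finset.mem_filter.1 (Finset.mem_filter.1 hu).1).2
      exact ⟨v, fun _ => hv⟩
    · exact ⟨u, fun h => absurd h hu⟩
  choose f hf using hpartner
  have hmass (l : List (Fin N)) : (∑ u ∈ U with u ∈ l, q u) / d ≤
      ∑ v ∈ (U.filter fun u => u ∈ l).image f, q v := by
    rw [div_le_iff₀' hd, Finset.mul_sum]
    calc ∑ u ∈ U with u ∈ l, q u ≤ ∑ u ∈ U with u ∈ l, q (f u) :=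
          Finset.sum_le_sum fun u hu => (hf u (Finset.mem_filter.1 hu).1).2
      _ = ∑ v ∈ (U.filter fun u => u ∈ l).image f,
            ∑ u ∈ U.filter (fun u => u ∈ l) with f u = v, q (f u) :=
          (Finset.sum_fiberwise_of_maps_to (fun u hu => Finset.mem_image_of_mem f hu) _).symm
      _ ≤ _ := by
          refine Finset.sum_le_sum fun v _ => ?_
          calc _ = ∑ u ∈ U.filter (fun u => u ∈ l) with f u = v, q v :=
                Finset.sum_congr rfl fun u hu => by rw [(Finset.mem_filter.1 hu).2]
            -- All nodes with partner `v` are negative neighbours of `v`, so there are at most `d`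
            -- of them.
            _ ≤ ∑ u, (if G.label v u = -1 then 1 else 0) * q v := by
                simp only [ite_mul, one_mul, zero_mul, ← Finset.sum_filter]
                refine Finset.sum_le_sum_of_subset_of_nonneg (fun u hu => ?_) fun _ _ _ => hq v
                simp only [Finset.mem_filter] at hu
                rw [Finset.mem_filter, G.symm, ← hu.2]
                exact ⟨Finset.mem_univ _, (hf u hu.1.1).1⟩
            _ ≤ d * q v := by
                rw [← Finset.sum_mul]
                exact mul_le_mul_of_nonneg_right (G.sum_label_eq_le A (by decide) v) (hq v)
  calc failProb A (a + b) L s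
      ≤ (walks L s a).expect A.answer fun l => (walks L s b).expect A.answer fun l' =>
          if ∃ v ∈ l', v ∈ (U.filter fun u => u ∈ l).image f then 0 else 1 := by
        refine (failProb_le A (a + b) L s).trans ?_
        rw [expect_walks_add]
        refine expect_mono _ fun l => expect_mono _ fun l' => ?_
        split_ifs with h1 h2 h2
        · rfl
        · norm_num
        · obtain ⟨v, hv, hvB⟩ := h2
          obtain ⟨u, hu, rfl⟩ := Finset.mem_image.1 hvB
          rw [Finset.mem_filter] at hu
          exact absurd ⟨u, List.mem_append_left _ hu.2, f u, List.mem_append_right _ hv,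
            (hf u hu.1).1⟩ h1
        · rfl
    _ ≤ (walks L s a).expect A.answer fun l =>
          Real.exp (-(b / d) * ∑ u ∈ U with u ∈ [] ++ l, q u) := by
        refine expect_mono _ fun l => (expect_walks_avoid_le A _ (hhit _) b).trans ?_
        have h1 : ∑ v ∈ (U.filter fun u => u ∈ l).image f, q v ≤ 1 := hq1 ▸
          Finset.sum_le_sum_of_subset_of_nonneg (Finset.subset_univ _) fun v _ _ => hq v
        have h2 := Real.add_one_le_exp (-∑ v ∈ (U.filter fun u => u ∈ l).image f, q v)
        calc _ ≤ Real.exp (-∑ v ∈ (U.filter fun u => u ∈ l).image f, q v) ^ b :=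
              pow_le_pow_left₀ (by linarith) (by linarith) b
          _ = Real.exp (b * -∑ v ∈ (U.filter fun u => u ∈ l).image f, q v) :=
              (Real.exp_nat_mul _ b).symm
          _ ≤ _ := by
              refine Real.exp_le_exp.2 ?_
              have h3 := mul_le_mul_of_nonneg_left (hmass l) (Nat.cast_nonneg (α := ℝ) b)
              rw [List.nil_append, mul_neg, neg_mul, neg_le_neg_iff]
              calc _ = (b : ℝ) * ((∑ u ∈ U with u ∈ l, q u) / d) := by ring
                _ ≤ _ := h3
    _ ≤ _ := by
        have := expect_exp_mass_le A hq hhit (U := U) (κ := 2 * γ / N) (γ := γ) (M := b / d)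
          (by positivity) (by positivity) hγ hγ1 (fun v hv => (Finset.mem_filter.1 hv).2) hUγ a []
        simpa using this

end Sampling

end ClusterTester

/-! ### Far graphs: averaging over the starting node -/

namespace ClusterTester

open QueryAlg

variable {N d : ℕ} {G : SignedGraph (Fin N)} (A : G.AdjList d)

theorem sum_positive_abs_sub_occupation_le [NeZero d] (A : G.AdjList d) {T : ℕ} (hT : T ≠ 0)
    {c : ℝ} (hc : 0 < c) :
    ∑ p ∈ G.edgePairs 1, ∑ s, |occupation G d T p.1 s - occupation G d T p.2 s| ≤
      d * (N * ((2 * c)⁻¹ * ((1 + Real.log (N * T)) / T) + 2 * c + 2 / T)) := by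
  have hd : (d : ℝ) ≠ 0 := Nat.cast_ne_zero.2 (NeZero.ne d)
  have hcol (v : Fin N) : ∑ u, transition G d u v = 1 := by
    rw [← transition_row_sum (G := G) (d := d) v]
    exact Finset.sum_congr rfl fun u _ => transition_isSymm.apply v u
  have h := sum_transition_mul_abs_sub_occupation_le (transition_nonneg A) hcol
    (transition_pow_nonneg A) transition_pow_row_sum hT rfl hc
  rw [Fintype.card_fin] at h
  set g : Fin N → Fin N → ℝ := fun v u => ∑ s, |occupation G d T u s - occupation G d T v s|
  have hg (u v : Fin N) : 0 ≤ g u v := Finset.sum_nonneg fun _ _ => abs_nonneg _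
  calc _ ≤ ∑ p ∈ G.edgePairs 1, (g p.1 p.2 + g p.2 p.1) :=
        Finset.sum_le_sum fun p _ => le_add_of_nonneg_left (hg _ _)
    _ ≤ ∑ v, ∑ u, if G.label v u = 1 then g v u else 0 := G.sum_edgePairs_le 1 hg
    _ ≤ ∑ v, ∑ u, d * (transition G d v u * g v u) := by
        refine Finset.sum_le_sum fun v _ => Finset.sum_le_sum fun u _ => ?_
        split_ifs with huv
        · rw [transition_ge huv]
          field_simp
          rfl
        · exact mul_nonneg (Nat.cast_nonneg _) (mul_nonneg (transition_nonneg A _ _) (hg _ _))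
    _ ≤ _ := by
        simp only [← Finset.mul_sum]
        exact mul_le_mul_of_nonneg_left h (Nat.cast_nonneg _)

/-- Repairing the rounded partition costs at least εdN. The positive edges account for at most
5εdN/16 and the rounding slack for εN/16, so the overlaps on negative edges supply the rest;
symmetry of the occupation matrix regroups them by starting node. -/
theorem le_sum_negativeWeight [NeZero d] (A : G.AdjList d) {ε : ℝ} (hε : 0 < ε)
    (hfar : G.FarFromClusterable d ε) {T : ℕ} (hT : T ≠ 0)
    (hsmall : 16 / ε * ((1 + Real.log (N * T)) / T) + 2 / T ≤ ε / 4) :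
    ε * d * N / 2 ≤ ∑ s, negativeWeight G (occupation G d T s) := by
  have hd : (1 : ℝ) ≤ d := by exact_mod_cast NeZero.one_le
  obtain ⟨π, hπ⟩ := exists_labelling (occupation_nonneg A T) (occupation_row_sum (G := G) hT)
    (δ := ε / 16) (by positivity) (G.edgePairs 1) (G.edgePairs (-1))
  have h1 := (hfar _ (G.repair_clusterable π)).trans (G.editDistance_repair_le π)
  have h2 := sum_positive_abs_sub_occupation_le A hT (c := ε / 32) (by positivity)
  have h3 : ∑ p ∈ G.edgePairs (-1), ∑ s, min (occupation G d T p.1 s) (occupation G d T p.2 s) =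
      ∑ s, negativeWeight G (occupation G d T s) := by
    simp only [negativeWeight]
    rw [Finset.sum_comm]
    simp only [occupation_symm T _ (Prod.fst _), occupation_symm T _ (Prod.snd _)]
  rw [h3, Fintype.card_fin] at hπ
  have h4 : (2 * (ε / 32))⁻¹ * ((1 + Real.log (N * T)) / T) + 2 * (ε / 32) + 2 / T ≤
      5 * ε / 16 := by
    rw [show (2 * (ε / 32))⁻¹ = 16 / ε by field_simp; norm_num]
    linarith
  have h5 : d * (N * ((2 * (ε / 32))⁻¹ * ((1 + Real.log (N * T)) / T) + 2 * (ε / 32) + 2 / T)) ≤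
      d * (N * (5 * ε / 16)) := by gcongr
  have h6 : ε * N ≤ ε * N * d := le_mul_of_one_le_right (by positivity) hd
  nlinarith

theorem sum_failProb_le [NeZero N] [NeZero d] {ε : ℝ} (hε : 0 < ε) {T : ℕ} (hT : T ≠ 0)
    (hweight : ε * d * N / 2 ≤ ∑ s, negativeWeight G (occupation G d T s)) {m L : ℕ}
    (hfail : ∀ s, ε * d / 4 ≤ negativeWeight G (occupation G d T s) → failProb A m L s ≤ 1 / 2) :
    (∑ s, failProb A m L s) / N ≤ 1 - ε / 8 := by
  classical
  have hd : (0 : ℝ) < d := Nat.cast_pos.2 (NeZero.pos d)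
  have hN : (0 : ℝ) < N := Nat.cast_pos.2 (NeZero.pos N)
  have hmax (s : Fin N) : negativeWeight G (occupation G d T s) ≤ d := by
    refine (negativeWeight_le A (occupation_nonneg A T s)).trans (mul_le_of_le_one_right hd.le ?_)
    rw [← occupation_row_sum (G := G) (d := d) hT s]
    exact Finset.sum_le_sum_of_subset_of_nonneg (Finset.subset_univ _)
      fun v _ _ => occupation_nonneg A T s v
  -- A linear bound replaces counting good nodes: it is at least 1/2 when the weight is large, since
  -- the weight never exceeds `d`, and at least 1 otherwise.
  have hterm (s : Fin N) : failProb A m L s ≤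
      1 + (2 * d : ℝ)⁻¹ * (ε * d / 4 - negativeWeight G (occupation G d T s)) := by
    by_cases h : ε * d / 4 ≤ negativeWeight G (occupation G d T s)
    · have h1 : (2 * d : ℝ)⁻¹ * (ε * d / 4 - negativeWeight G (occupation G d T s)) ≥
          (2 * d : ℝ)⁻¹ * (ε * d / 4 - d) := by
        have := hmax s
        gcongr
      have h2 : (2 * d : ℝ)⁻¹ * (ε * d / 4 - d) = ε / 8 - 1 / 2 := by field_simp; ring
      have := hfail s h
      linarith
    · push Not at h
      have h1 : 0 ≤ (2 * d : ℝ)⁻¹ * (ε * d / 4 - negativeWeight G (occupation G d T s)) :=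
        mul_nonneg (by positivity) (by linarith)
      have := failProb_le_one A m L s
      linarith
  rw [div_le_iff₀ hN]
  refine (Finset.sum_le_sum fun s _ => hterm s).trans ?_
  rw [Finset.sum_add_distrib, ← Finset.mul_sum, Finset.sum_sub_distrib]
  simp only [Finset.sum_const, Finset.card_univ, Fintype.card_fin, nsmul_eq_mul, mul_one]
  have h1 : (2 * d : ℝ)⁻¹ * (N * (ε * d / 4) - ∑ s, negativeWeight G (occupation G d T s)) ≤
      (2 * d : ℝ)⁻¹ * (N * (ε * d / 4) - ε * d * N / 2) := by gcongr
  have h2 : (2 * d : ℝ)⁻¹ * (N * (ε * d / 4) - ε * d * N / 2) = -(ε / 8 * N) := by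
    field_simp
    ring
  linarith

/-! ### Choice of parameters -/

section Parameters

theorem exp_neg_le_one_div {x y : ℝ} (hx : 0 ≤ x) (hxy : x ≤ y) :
    Real.exp (-y) ≤ 1 / (1 + x) := by
  rw [Real.exp_neg, inv_eq_one_div]
  gcongr
  linarith [Real.add_one_le_exp y]

theorem phase_failure_le {N d γ : ℝ} {a b : ℕ} (hN : 0 < N) (hd : 0 < d)
    (hγ : 0 ≤ γ) (hγ1 : γ ≤ 1) (ha : 6 ≤ a * γ) (hb : 3 ≤ b / d * γ)
    (hab : 6 ≤ a * γ * (b / d * (2 * γ / N))) :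
    (1 - γ * (1 - Real.exp (-(b / d) * (2 * γ / N)))) ^ a + Real.exp (-(b / d) * γ) ≤ 1 / 2 := by
  set y : ℝ := b / d * (2 * γ / N) with hy
  have hy0 : 0 ≤ y := by positivity
  have h1 : Real.exp (-(b / d) * (2 * γ / N)) ≤ 1 / (1 + y) := by
    rw [neg_mul]
    exact exp_neg_le_one_div hy0 le_rfl
  have h2 : Real.exp (-(b / d) * γ) ≤ 1 / (1 + 3) := by
    rw [neg_mul]
    exact exp_neg_le_one_div (by norm_num) hb
  have h3 : (1 - γ * (1 - Real.exp (-(b / d) * (2 * γ / N)))) ^ a ≤ 1 / (1 + 3) := by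
    have h4 : γ * (y / (1 + y)) ≤ γ * (1 - Real.exp (-(b / d) * (2 * γ / N))) := by
      gcongr
      have : y / (1 + y) = 1 - 1 / (1 + y) := by field_simp; ring
      linarith
    have h5 : γ * (1 - Real.exp (-(b / d) * (2 * γ / N))) ≤ 1 := by
      have := Real.exp_pos (-(b / d) * (2 * γ / N))
      nlinarith
    calc _ ≤ Real.exp (-(γ * (y / (1 + y)))) ^ a := by
          refine pow_le_pow_left₀ (by linarith) ?_ a
          have := Real.add_one_le_exp (-(γ * (y / (1 + y))))
          linarith
      _ = Real.exp (-(a * (γ * (y / (1 + y))))) := by rw [← Real.exp_nat_mul, mul_neg]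
      _ ≤ _ := by
          refine exp_neg_le_one_div (by norm_num) ?_
          rw [show a * (γ * (y / (1 + y))) = a * γ * y / (1 + y) by ring,
            le_div_iff₀ (by positivity)]
          -- Half of `a * γ * y` is at least 3 by `hab`, and the other half is at least 3y by `ha`;
          -- together they exceed 3(1 + y).
          nlinarith
  have h4 : (1 / (1 + 3) : ℝ) = 1 / 4 := by norm_num
  linarith

theorem mixing_error_le {N ε X : ℝ} {T : ℕ} (hN : 1 ≤ N) (hε : 0 < ε) (hX1 : 1 ≤ X)
    (hXε : 1 + Real.log N ≤ X * ε)
    (hT : 2 ^ 20 * X ^ 4 ≤ T) :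
    16 / ε * ((1 + Real.log (N * T)) / T) + 2 / T ≤ ε / 4 := by
  have hlog : 0 ≤ Real.log N := Real.log_nonneg hN
  have hX : 0 < X := by linarith
  have hT0 : (0 : ℝ) < T := lt_of_lt_of_le (by positivity) hT
  -- With t = √T, log T = 2 log t ≤ 2t, so log T / T is at most 2/t; this is why `T` has order `X ^
  -- 4`.
  obtain ⟨t, ht, htT⟩ : ∃ t : ℝ, 0 < t ∧ (T : ℝ) = t ^ 2 :=
    ⟨√T, Real.sqrt_pos.2 hT0, (Real.sq_sqrt hT0.le).symm⟩
  have htX : 2 ^ 10 * X ^ 2 ≤ t := by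
    refine le_of_sq_le_sq ?_ ht.le
    rw [← htT]
    nlinarith
  have hlt : Real.log T ≤ 2 * t := by
    have := Real.log_le_sub_one_of_pos ht
    rw [htT, Real.log_pow]
    push_cast
    linarith
  have hX2 : 1 ≤ X * ε := by linarith
  have htε : 512 ≤ t * ε ^ 2 := by
    calc (512 : ℝ) ≤ 2 ^ 10 * (X * ε) ^ 2 := by nlinarith
      _ = 2 ^ 10 * X ^ 2 * ε ^ 2 := by ring
      _ ≤ t * ε ^ 2 := by gcongr
  have hTε : 1024 * X ≤ T * ε := by
    calc 1024 * X ≤ 2 ^ 20 * (1 * X) * 1 := by linarith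
      _ ≤ 2 ^ 20 * (X ^ 2 * X) * (X * ε) := by
          gcongr
          exact one_le_pow₀ hX1
      _ = 2 ^ 20 * X ^ 4 * ε := by ring
      _ ≤ T * ε := by gcongr
  have e1 : X * ε / T ≤ ε ^ 2 / 1024 := by
    rw [div_le_div_iff₀ hT0 (by norm_num)]
    nlinarith
  have e2 : 2 * t / T ≤ ε ^ 2 / 256 := by
    rw [htT, div_le_div_iff₀ (by positivity) (by norm_num)]
    nlinarith
  have e3 : 2 / (T : ℝ) ≤ ε / 64 := by
    rw [div_le_div_iff₀ hT0 (by norm_num)]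
    nlinarith
  have e4 : (1 + Real.log (N * T)) / T ≤ ε ^ 2 / 1024 + ε ^ 2 / 256 := by
    rw [Real.log_mul (by linarith) hT0.ne', ← add_assoc, add_div]
    refine add_le_add (le_trans ?_ e1) (le_trans ?_ e2) <;> gcongr
  have e5 : 16 / ε * (ε ^ 2 / 1024 + ε ^ 2 / 256) = 5 * ε / 64 := by
    field_simp
    norm_num
  have e6 := mul_le_mul_of_nonneg_left e4 (by positivity : 0 ≤ 16 / ε)
  linarith

theorem numWalks_split {N d ε X : ℝ} {m : ℕ} (hN : 1 ≤ N) (hd : 1 ≤ d) (hε : 0 < ε)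
    (hX1 : 1 ≤ X) (hXd : d ≤ X * ε) (hm : 2 ^ 20 * √N * X ^ 4 ≤ m) :
    6 ≤ (m / 2 : ℕ) * (ε / 16) ∧ 3 ≤ (m - m / 2 : ℕ) / d * (ε / 16) ∧
      6 ≤ (m / 2 : ℕ) * (ε / 16) * ((m - m / 2 : ℕ) / d * (2 * (ε / 16) / N)) := by
  have hs : 1 ≤ √N := Real.one_le_sqrt.2 hN
  have hX3 : 1 ≤ X ^ 3 := one_le_pow₀ hX1
  have hX4 : 1 ≤ X ^ 4 := one_le_pow₀ hX1
  have hm1 : (2 : ℝ) ≤ m := by nlinarith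
  have hm2 : 2 ≤ m := by exact_mod_cast hm1
  have ha : (m : ℝ) / 4 ≤ (m / 2 : ℕ) := by
    rw [div_le_iff₀ (by norm_num)]
    norm_cast
    omega
  have hb : (m : ℝ) / 2 ≤ (m - m / 2 : ℕ) := by
    rw [div_le_iff₀ (by norm_num)]
    norm_cast
    omega
  have hmε : 2 ^ 20 * √N * d ≤ m * ε := by
    calc 2 ^ 20 * √N * d ≤ 2 ^ 20 * √N * (X ^ 3 * (X * ε)) := by
          gcongr
          nlinarith
      _ = 2 ^ 20 * √N * X ^ 4 * ε := by ring
      _ ≤ m * ε := by gcongr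
  have hsd : 1 ≤ √N * d := one_le_mul_of_one_le_of_one_le hs hd
  have hA : 2 ^ 14 * √N * d ≤ (m / 2 : ℕ) * (ε / 16) := by nlinarith
  have hB : 2 ^ 15 * √N ≤ (m - m / 2 : ℕ) / d * (ε / 16) := by
    rw [div_mul_eq_mul_div, le_div_iff₀ (by linarith)]
    nlinarith
  refine ⟨by nlinarith, by nlinarith, ?_⟩
  have hB2 : 2 ^ 16 * √N / N ≤ (m - m / 2 : ℕ) / d * (2 * (ε / 16) / N) := by
    rw [← mul_div_assoc]
    exact div_le_div_of_nonneg_right (by linarith) (by linarith)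
  -- The birthday effect: both phases contribute a factor √N, and the product cancels the N in the
  -- minimal node mass.
  calc (6 : ℝ) ≤ 2 ^ 14 * √N * d * (2 ^ 16 * √N / N) := by
        rw [← mul_div_assoc, le_div_iff₀ (by linarith)]
        have : 2 ^ 14 * √N * d * (2 ^ 16 * √N) = 2 ^ 30 * (√N * √N) * d := by ring
        rw [this, Real.mul_self_sqrt (by linarith)]
        nlinarith
    _ ≤ _ := by gcongr

theorem pow_numStarts_le {ε F : ℝ} {r : ℕ} (hε : 0 < ε) (hF0 : 0 ≤ F) (hF : F ≤ 1 - ε / 8)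
    (hr : 2 ^ 20 / ε ≤ r) : F ^ r ≤ 1 / 3 := by
  calc F ^ r ≤ Real.exp (-(ε / 8)) ^ r := by
        refine pow_le_pow_left₀ hF0 ?_ r
        linarith [Real.add_one_le_exp (-(ε / 8))]
    _ = Real.exp (-(r * (ε / 8))) := by rw [← Real.exp_nat_mul, mul_neg]
    _ ≤ 1 / (1 + 2) := by
        refine exp_neg_le_one_div (by norm_num) ?_
        rw [div_le_iff₀ hε] at hr
        linarith
    _ = 1 / 3 := by norm_num

theorem queryBound_le {N ε X : ℝ} {r m L D : ℕ} (hN : 1 ≤ N)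
    (hX1 : 1 ≤ X) (hXd : D ≤ X) (hXε : 1 / ε ≤ X) (hr : (r : ℝ) < 2 ^ 20 / ε + 1)
    (hm : (m : ℝ) < 2 ^ 20 * √N * X ^ 4 + 1) (hL : (L : ℝ) < 2 ^ 20 * X ^ 4 + 1) :
    ((r * (m * (L + 1) * (D + 1)) : ℕ) : ℝ) ≤ 2 ^ 64 * √N * X ^ 10 := by
  have hs : 1 ≤ √N := Real.one_le_sqrt.2 hN
  have hX4 : 1 ≤ X ^ 4 := one_le_pow₀ hX1
  have hsX : 1 ≤ √N * X ^ 4 := one_le_mul_of_one_le_of_one_le hs hX4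
  have h1 : (r : ℝ) ≤ 2 ^ 21 * X := by
    have : 2 ^ 20 / ε = 2 ^ 20 * (1 / ε) := by ring
    nlinarith
  have h2 : (m : ℝ) ≤ 2 ^ 21 * (√N * X ^ 4) := by nlinarith
  have h3 : (L : ℝ) + 1 ≤ 2 ^ 21 * X ^ 4 := by nlinarith
  have h4 : (D : ℝ) + 1 ≤ 2 * X := by linarith
  push_cast
  calc (r : ℝ) * (m * (L + 1) * (D + 1))
      ≤ 2 ^ 21 * X * (2 ^ 21 * (√N * X ^ 4) * (2 ^ 21 * X ^ 4) * (2 * X)) := by gcongr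
    _ = 2 ^ 64 * (√N * X ^ 10) := by ring
    _ = _ := by ring

end Parameters

end ClusterTester

/-! ### Assembly of the theorem -/

theorem mainTheorem1 :
    ∃ C k C' k' : ℕ, ∀ (N d : ℕ) [NeZero N] [NeZero d] (ε : ℝ), 0 < ε → ε ≤ 1 →
      ∀ (G : SignedGraph (Fin N)) (A : G.AdjList d),
        -- clusterable graphs are always accepted
        (G.Clusterable →
          ((ClusterTester.tester N d (ClusterTester.numWalks C k N d ε)
            (ClusterTester.walkLength C k N d ε) (ClusterTester.numStarts C ε)).eval A.answer)
              .accept = 1) ∧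
        -- graphs that are far from clusterable are rejected with probability at least `2/3`
        (G.FarFromClusterable d ε →
          2 / 3 ≤ ((ClusterTester.tester N d (ClusterTester.numWalks C k N d ε)
            (ClusterTester.walkLength C k N d ε) (ClusterTester.numStarts C ε)).eval A.answer)
              .reject) ∧
        -- every edge returned by the subroutine is negative and lies on a bad cycle
        (∀ s u v : Fin N,
          some (u, v) ∈ ((ClusterTester.badCycle (ClusterTester.numWalks C k N d ε)
            (ClusterTester.walkLength C k N d ε) s).eval A.answer).support →
          G.label u v = -1 ∧
            ∃ w : G.graph.Walk u u, G.IsBadCycle w ∧ s(u, v) ∈ w.edges) ∧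
        -- the worst-case number of queries
        ((ClusterTester.tester N d (ClusterTester.numWalks C k N d ε)
          (ClusterTester.walkLength C k N d ε) (ClusterTester.numStarts C ε)).queryCount
            A.answer : ℝ)
          ≤ C' * √(N : ℝ) * (d * (1 + Real.log N) / ε) ^ k' := by
  -- The exponent 10 is 1 + 4 + 4 + 1, from the rounds, the walks, their length and the degree; 2 ^
  -- 64 is three factors 2 ^ 21, which absorb the ceilings, times 2 for `d + 1`.
  refine ⟨2 ^ 20, 4, 2 ^ 64, 10, fun N d _ _ ε hε hε1 G A => ?_⟩
  have hN : (1 : ℝ) ≤ N := by exact_mod_cast NeZero.one_le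
  have hd : (1 : ℝ) ≤ d := by exact_mod_cast NeZero.one_le
  have hlog : 0 ≤ Real.log N := Real.log_nonneg hN
  set X : ℝ := d * (1 + Real.log N) / ε with hX
  have hXmul : X * ε = d * (1 + Real.log N) := div_mul_cancel₀ _ hε.ne'
  have hXd : d ≤ X * ε := by nlinarith
  have hXlog : 1 + Real.log N ≤ X * ε := by nlinarith
  have hXε : 1 / ε ≤ X := by
    rw [div_le_iff₀ hε]
    linarith
  have hX1 : 1 ≤ X := le_trans (by rw [le_div_iff₀ hε]; linarith) hXε
  set m := ClusterTester.numWalks (2 ^ 20) 4 N d ε with hm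
  set L := ClusterTester.walkLength (2 ^ 20) 4 N d ε with hL
  set r := ClusterTester.numStarts (2 ^ 20) ε with hr
  have hC : ((2 ^ 20 : ℕ) : ℝ) = 2 ^ 20 := by norm_num
  have hm1 : 2 ^ 20 * √(N : ℝ) * X ^ 4 ≤ m := by
    rw [hm, ClusterTester.numWalks, hC]
    exact Nat.le_ceil _
  have hL1 : 2 ^ 20 * X ^ 4 ≤ L := by
    rw [hL, ClusterTester.walkLength, hC]
    exact Nat.le_ceil _
  have hr1 : 2 ^ 20 / ε ≤ r := by
    rw [hr, ClusterTester.numStarts, hC]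
    exact Nat.le_ceil _
  have hm2 : m < 2 ^ 20 * √(N : ℝ) * X ^ 4 + 1 := by
    rw [hm, ClusterTester.numWalks, hC]
    exact Nat.ceil_lt_add_one (by positivity)
  have hL2 : L < 2 ^ 20 * X ^ 4 + 1 := by
    rw [hL, ClusterTester.walkLength, hC]
    exact Nat.ceil_lt_add_one (by positivity)
  have hr2 : r < 2 ^ 20 / ε + 1 := by
    rw [hr, ClusterTester.numStarts, hC]
    exact Nat.ceil_lt_add_one (by positivity)
  refine ⟨fun hG => ClusterTester.eval_tester_accept_of_clusterable A hG m L r, fun hfar => ?_,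
    fun s u v h => ?_, ?_⟩
  · have hT : 2 ^ 20 * X ^ 4 ≤ ((L + 1 : ℕ) : ℝ) := by
      push_cast
      linarith
    have hweight := ClusterTester.le_sum_negativeWeight A hε hfar L.succ_ne_zero
      (ClusterTester.mixing_error_le hN hε hX1 hXlog hT)
    obtain ⟨ha, hb, hab⟩ := ClusterTester.numWalks_split hN hd hε hX1 hXd hm1
    have hfail (s : Fin N)
        (hs : ε * d / 4 ≤ ClusterTester.negativeWeight G (ClusterTester.occupation G d (L + 1) s)) :
        ClusterTester.failProb A m L s ≤ 1 / 2 := by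
      -- With γ = ε/16 the required weight 4γd is exactly εd/4; the walks are split into two halves
      -- for the two phases.
      have h := ClusterTester.failProb_le_of_negativeWeight A
        (ClusterTester.occupation_nonneg A (L + 1) s)
        (ClusterTester.occupation_row_sum L.succ_ne_zero s)
        (fun B => ClusterTester.occupation_le_expect_walk A B L s) (γ := ε / 16) (by positivity)
        (by linarith) (m / 2) (m - m / 2)
      rw [Nat.add_sub_cancel' (Nat.div_le_self m 2)] at h
      exact h.trans (ClusterTester.phase_failure_le (by linarith) (by linarith) (by positivity)
        (by linarith) ha hb hab)
    have hF := ClusterTester.sum_failProb_le A hε L.succ_ne_zero hweight hfail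
    have hpow := ClusterTester.pow_numStarts_le hε (div_nonneg (Finset.sum_nonneg fun s _ =>
      ClusterTester.failProb_nonneg A m L s) (Nat.cast_nonneg N)) hF hr1
    rw [ClusterTester.eval_tester_reject]
    calc (2 / 3 : ENNReal) = ENNReal.ofReal (2 / 3) := by
          rw [ENNReal.ofReal_div_of_pos (by norm_num)]
          norm_num
      _ ≤ _ := ENNReal.ofReal_le_ofReal (by linarith)
  · obtain ⟨huv, hu, hv⟩ := ClusterTester.mem_support_badCycle A h
    exact ⟨huv, ClusterTester.exists_isBadCycle huv (hv.symm.trans hu)⟩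
  · have hXd' : (d : ℝ) ≤ X := hXd.trans (mul_le_of_le_one_right (by linarith) hε1)
    refine (Nat.cast_le.2 (ClusterTester.queryCount_tester A m L r)).trans ?_
    rw [show ((2 ^ 64 : ℕ) : ℝ) = 2 ^ 64 by norm_num]
    exact ClusterTester.queryBound_le hN hX1 hXd' hXε hr2 hm2 hL2
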